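/- **Setting.** Let $n\ge 1$, let $\mu$ be Lebesgue measure on $\mathbb R^n$, $\operatorname{ci}(A)$ the closure of the interior of $A$, and $d_\mu(A,B)=\mu(A\,\Delta\,B)$. Let $\mathfrak L_n$ be the Lebesgue measurable sets of finite measure and $\mathfrak J_n$ the bounded sets $A=\operatorname{ci}(A)$ with $\mu(\partial A)=0$. **Measure average.** Fix $N>1$ and $\varepsilon>0$, and for every nonempty bounded set $A$ a center $q_A\in A$ maximizing $d_S(\cdot,A)$ over $A$, where the signed distance $d_S(p,A)$ is $d(p,\partial A)$ if $p\in A$ and $-d(p,\partial A)$ if $p\notin A$. For $B\subseteq A$, $A\neq\emptyset$, $x\in\mathbb R$, put $f_{A,B,x}(p)=x\,d_S(p,A)+(1-x)\,d_S(p,B)$ if $B\ne\emptyset$ and $f_{A,\emptyset,x}(p)=x\,d_S(p,A)+(x-1)\|p-q_A\|$. Put also $D_{A,B,x}=\{p: f_{A,B,x}(p)\ge 0\}$ and $c_{A,B}(t)=t\mu(A)+(1-t)\mu(B)$. (1) *Simple average.* If $\mu\{f_{A,B,1/2}=0\}=0$ or $t\notin[0,1]$, let $S_{A,B,t}=\operatorname{ci}(D_{A,B,g})$,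 where $g$ is any minimizer of $x\mapsto|\mu(D_{A,B,x})-c_{A,B}(t)|$ over $[-N,N]$. Otherwise let $S_{A,B,t}=\operatorname{ci}(\{p:d(p,B)\le r\}\cap A)$, where $r\ge 0$ is any number with $\mu(\{p:d(p,B)\le r\}\cap A)=c_{A,B}(t)$. (2) *Nested sets.* For $B\subsetneq A$ in $\mathfrak J_n$ let $\mathcal C$ be the set of connected components of $A\setminus B$ if there are finitely many of them; otherwise let $\mathcal C$ consist of the components of measure at least $\varepsilon$ and of the union of all the other components. Then $tA\oplus(1-t)B$ is $\bigcup_{C\in\mathcal C}S_{B\cup C,B,t}$ if $t\ge 0$ and $\operatorname{ci}\bigl(\bigcap_{C\in\mathcal C}S_{B\cup C,B,t}\bigr)$ if $t<0$. Moreover $tA\oplus(1-t)A=A$. (3) *General sets.* For $A,B\in\mathfrak J_n$ let $I=\operatorname{ci}(A\cap B)$ and, in the sense of (2), $R_{1}=tA\oplus(1-t)I$, $R_{2}=(1-t)B\oplus tI$. Then $tA\oplus(1-t)B$ is $R_1\cup R_2$ if $t\in[0,1]$, it is $\operatorname{ci}(R_1\setminus(A\cap B))\cup R_2$ if $t>1$,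 and it is $(1-t)B\oplus tA$ (the case just defined, with the roles of the two sets exchanged) if $t<0$. **The 4-point scheme.** Let $0\le w<\frac18$, $h>0$, $\delta\in[0,h)$. From initial sets $F_i^0\in\mathfrak J_n$ ($i\in\mathbb Z$) define, for $k\ge 0$, $F_{2i}^{k+1}=F_i^k$ and $$F_{2i+1}^{k+1}=\tfrac12\bigl((-2w)F_{i-1}^k\oplus(1+2w)F_i^k\bigr)\oplus\tfrac12\bigl((-2w)F_{i+2}^k\oplus(1+2w)F_{i+1}^k\bigr).$$ The interpolant of level $k$ is $$F_k(x)=\lambda F_i^k\oplus(1-\lambda)F_{i+1}^k,\qquad \lambda=(i+1)-\frac{2^k(x-\delta)}{h},\qquad \delta+ih2^{-k}\le x\le\delta+(i+1)h2^{-k}.$$ **Theorem.** Let $0<\nu\le 1$ and let $G:\mathbb R\to\mathfrak J_n$ satisfy $d_\mu(G(s),G(t))\le H|s-t|^\nu$ for all $s,t\in\mathbb R$. Let $F_i^0=G(\delta+ih)$, $i\in\mathbb Z$. Then, for all $k\ge0$ and $x\in\mathbb R$, $F_k(x)\in\mathfrak J_n$ and $$d_\mu(G(x),F_k(x))\le C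 h^\nu,\qquad C=\Bigl(2^{-\nu}+\tfrac12+\frac{1+4w}{1/2-4w}\Bigr)H .$$ Moreover, $F_k$ converges, uniformly on $\mathbb R$ with respect to $d_\mu$, to a limit $F^\infty:\mathbb R\to\mathfrak L_n$, and every such limit satisfies $d_\mu(F^\infty(x),G(x))\le C h^\nu$ for all $x\in\mathbb R$. -/

import Mathlib

open Set MeasureTheory Filter Topology

noncomputable section

namespace SetSubdivision

/-- The Euclidean space `ℝⁿ`. -/
abbrev E (n : ℕ) := EuclideanSpace ℝ (Fin n)

variable {n : ℕ}

/-- The closure of the interior. -/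
def ci (A : Set (E n)) : Set (E n) := closure (interior A)

/-- The Lebesgue measurable sets of finite measure. -/
def LSets (n : ℕ) : Set (Set (E n)) :=
  {A | NullMeasurableSet A volume ∧ volume A < ⊤}

/-- The regular compact Jordan measurable sets. -/
def JSets (n : ℕ) : Set (Set (E n)) :=
  {A | Bornology.IsBounded A ∧ ci A = A ∧ volume (frontier A) = 0}

/-- The measure of the symmetric difference. -/
def dMu (A B : Set (E n)) : ℝ := volume.real (symmDiff A B)

open Classical in
/-- The signed distance from `p` to (the boundary of) `A`: nonnegative on `A`, negative outside
the closure of `A`. -/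
def signedDist (p : E n) (A : Set (E n)) : ℝ :=
  if p ∈ A then Metric.infDist p (frontier A) else -Metric.infDist p (frontier A)

/-- `q` is a deepest point of `A`. -/
def IsCenter (A : Set (E n)) (q : E n) : Prop :=
  q ∈ A ∧ ∀ a ∈ A, signedDist a A ≤ signedDist q A

open Classical in
/-- The function whose nonnegativity set is the distance average of `A ≠ ∅` (weight `x`) and `B`
(weight `1 - x`); when `B = ∅`, the signed distance to `B` is replaced by minus the distance to the
chosen center of `A`. It is only applied to pairs with `A ≠ ∅`. -/
def distFun (center : Set (E n) → E n) (A B : Set (E n)) (x : ℝ) (p : E n) : ℝ :=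
  if B = ∅ then x * signedDist p A + (x - 1) * ‖p - center A‖
  else x * signedDist p A + (1 - x) * signedDist p B

/-- The distance average. -/
def distAvg (center : Set (E n) → E n) (A B : Set (E n)) (x : ℝ) : Set (E n) :=
  {p | 0 ≤ distFun center A B x p}

/-- The zero-measure condition on a pair of sets. -/
def ZeroMeasureCond (center : Set (E n) → E n) (A B : Set (E n)) : Prop :=
  volume {p | distFun center A B (1 / 2) p = 0} = 0

/-- The average of the measures of `A` and `B`. -/
def targetMeasure (A B : Set (E n)) (t : ℝ) : ℝ :=
  t * volume.real A + (1 - t) * volume.real B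

/-- `x` minimizes, over `[-N, N]`, the discrepancy between the measure of the distance average with
parameter `x` and the average of the measures with parameter `t`. -/
def IsReparam (center : Set (E n) → E n) (N : ℝ) (A B : Set (E n)) (t x : ℝ) : Prop :=
  x ∈ Icc (-N) N ∧
    ∀ y ∈ Icc (-N) N, |volume.real (distAvg center A B x) - targetMeasure A B t| ≤
      |volume.real (distAvg center A B y) - targetMeasure A B t|

/-- The `r`-offset of `B` (used for nonempty `B`). -/
def offset (B : Set (E n)) (r : ℝ) : Set (E n) := {p | Metric.infDist p B ≤ r}

/-- The part of `A` in the `r`-offset of `B` has the average measure with parameter `t`. -/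
def IsOffsetRadius (A B : Set (E n)) (t r : ℝ) : Prop :=
  0 ≤ r ∧ volume.real (offset B r ∩ A) = targetMeasure A B t

/-- The constants and the arbitrary selections on which the construction of the measure average
depends: the search bound `N`, the threshold `ε` below which components are merged (when there are
infinitely many), a center of every nonempty bounded set, and one element of each of the two
collections of admissible parameters, whenever these are nonempty. -/
structure AverageChoices (n : ℕ) where
  N : ℝ
  one_lt_N : 1 < N
  ε : ℝ
  ε_pos : 0 < ε
  center : Set (E n) → E n
  center_spec : ∀ A : Set (E n), A.Nonempty → Bornology.IsBounded A → IsCenter A (center A)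
  g : Set (E n) → Set (E n) → ℝ → ℝ
  g_spec : ∀ A B t, (∃ x, IsReparam center N A B t x) → IsReparam center N A B t (g A B t)
  r : Set (E n) → Set (E n) → ℝ → ℝ
  r_spec : ∀ A B t, (∃ s, IsOffsetRadius A B t s) → IsOffsetRadius A B t (r A B t)

/-- Every nonempty bounded set has a center. -/
theorem exists_isCenter (A : Set (E n)) (hA : A.Nonempty) (hb : Bornology.IsBounded A) :
    ∃ q, IsCenter A q := by
  obtain ⟨q, hq, hmax⟩ := hb.isCompact_closure.exists_isMaxOn hA.closure
    (Metric.continuous_infDist_pt (frontier A)).continuousOn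
  by_cases hqA : q ∈ A
  · refine ⟨q, hqA, fun a ha => ?_⟩
    simpa [signedDist, hqA, ha] using hmax (subset_closure ha)
  · have hf : q ∈ frontier A := ⟨hq, fun h => hqA (interior_subset h)⟩
    have h0 : Metric.infDist q (frontier A) = 0 := Metric.infDist_zero_of_mem hf
    obtain ⟨b, hbA⟩ := hA
    refine ⟨b, hbA, fun a ha => ?_⟩
    have h1 : Metric.infDist a (frontier A) ≤ Metric.infDist q (frontier A) :=
      hmax (subset_closure ha)
    have h2 : 0 ≤ Metric.infDist b (frontier A) := Metric.infDist_nonneg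
    simp only [signedDist, ha, hbA, if_true]
    linarith

open Classical in
/-- Admissible selections exist. -/
instance : Nonempty (AverageChoices n) := by
  refine ⟨{ N := 2, one_lt_N := by norm_num, ε := 1, ε_pos := one_pos,
            center := fun A => Classical.epsilon (IsCenter A)
            center_spec := fun A hA hb => Classical.epsilon_spec (exists_isCenter A hA hb)
            g := fun A B t => Classical.epsilon
              (IsReparam (fun A => Classical.epsilon (IsCenter A)) 2 A B t)
            g_spec := fun A B t h => Classical.epsilon_spec h
            r := fun A B t => Classical.epsilon (IsOffsetRadius A B t)
            r_spec := fun A B t h => Classical.epsilon_spec h }⟩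

open Classical in
/-- The measure average `tA ⊕ (1-t)B` for `B ⊆ A` simply different. -/
def simpleAvg (P : AverageChoices n) (A B : Set (E n)) (t : ℝ) : Set (E n) :=
  if ZeroMeasureCond P.center A B ∨ t ∉ Icc (0 : ℝ) 1 then
    ci (distAvg P.center A B (P.g A B t))
  else ci (offset B (P.r A B t) ∩ A)

/-- The connected components of `D`. -/
def components (D : Set (E n)) : Set (Set (E n)) :=
  {C | ∃ x ∈ D, C = connectedComponentIn D x}

open Classical in
/-- The pieces of `A \ B`: its connected components if these are finitely many; otherwise the
components of measure at least `ε`, together with the union of all the other components. -/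
def pieces (P : AverageChoices n) (A B : Set (E n)) : Set (Set (E n)) :=
  if (components (A \ B)).Finite then components (A \ B)
  else insert (⋃₀ {C ∈ components (A \ B) | volume.real C < P.ε})
    {C ∈ components (A \ B) | P.ε ≤ volume.real C}

open Classical in
/-- The measure average `tA ⊕ (1-t)B` for nested sets `B ⊆ A`. -/
def nestedAvg (P : AverageChoices n) (A B : Set (E n)) (t : ℝ) : Set (E n) :=
  if A = B then A
  else if 0 ≤ t then ⋃ C ∈ pieces P A B, simpleAvg P (B ∪ C) B t
  else ci (⋂ C ∈ pieces P A B, simpleAvg P (B ∪ C) B t)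

/-- The measure average `tA ⊕ (1-t)B` in the extrapolation range `t > 1`. -/
def extrapAvg (P : AverageChoices n) (A B : Set (E n)) (t : ℝ) : Set (E n) :=
  ci (nestedAvg P A (ci (A ∩ B)) t \ (A ∩ B)) ∪ nestedAvg P B (ci (A ∩ B)) (1 - t)

open Classical in
/-- The measure average `tA ⊕ (1-t)B`. For `t < 0` it is `(1-t)B ⊕ tA`, by symmetry. -/
def measureAvg (P : AverageChoices n) (A B : Set (E n)) (t : ℝ) : Set (E n) :=
  if t < 0 then extrapAvg P B A (1 - t)
  else if t ≤ 1 then nestedAvg P A (ci (A ∩ B)) t ∪ nestedAvg P B (ci (A ∩ B)) (1 - t)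
  else extrapAvg P A B t

/-- The sets `F_j^k` produced by the set-valued 4-point scheme with tension parameter `w`
(for odd `j = 2i + 1`, `j / 2 = i`). -/
def fourPoint (P : AverageChoices n) (w : ℝ) (F₀ : ℤ → Set (E n)) : ℕ → ℤ → Set (E n)
  | 0 => F₀
  | k + 1 => fun j =>
      let F := fourPoint P w F₀ k
      let i := j / 2
      if Even j then F i
      else measureAvg P (measureAvg P (F (i - 1)) (F i) (-2 * w))
        (measureAvg P (F (i + 2)) (F (i + 1)) (-2 * w)) (1 / 2)

/-- The piecewise interpolant, by the measure average, of the sets `F i` placed at the points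
`δ + i h`, `i ∈ ℤ`: on `[δ + i h, δ + (i+1) h)` it is `λ F_i ⊕ (1-λ) F_{i+1}` with
`λ = (i+1) - (x-δ)/h`. -/
def interpolant (P : AverageChoices n) (δ h : ℝ) (F : ℤ → Set (E n)) (x : ℝ) : Set (E n) :=
  let i : ℤ := ⌊(x - δ) / h⌋
  measureAvg P (F i) (F (i + 1)) ((i + 1 : ℝ) - (x - δ) / h)

/-- The interpolant `F_k` of level `k` of the 4-point scheme, when the initial sets are
placed at `δ + i h`. -/
def fourPointInterpolant (P : AverageChoices n) (w δ h : ℝ) (F₀ : ℤ → Set (E n)) (k : ℕ) :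
    ℝ → Set (E n) :=
  interpolant P δ (h / 2 ^ k) (fourPoint P w F₀ k)

/-- `Finf` has values in `LSets n`, and `F k` converges to it uniformly with respect to `dMu`. -/
def IsUniformLimit (F : ℕ → ℝ → Set (E n)) (Finf : ℝ → Set (E n)) : Prop :=
  (∀ x, Finf x ∈ LSets n) ∧
    ∀ η > 0, ∃ K : ℕ, ∀ k ≥ K, ∀ x, dMu (F k x) (Finf x) ≤ η

end SetSubdivision

end

open Set MeasureTheory Filter Topology

noncomputable section

namespace SetSubdivision

/-! The proof separates a metric part from a geometric part. The metric part uses only that averages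
stay in `JSets n` and satisfy two estimates in `dMu`. For `0 ≤ t ≤ 1`, the average lies within
`(1-t) d(A,B)` of `A` and within `t d(A,B)` of `B` (`convexAvg_spec`). For `t ≤ 0`, it lies within
`-t d(A,B)` of `B` (`measureAvg_nonpos_spec`). If neighbouring sets are at distance at most `L`, the
two extrapolations move sets by at most `2wL`. Taking the midpoint then leaves new neighbours within
`θL`, where `θ = 1/2 + 4w < 1` because `w < 1/8`. Consecutive interpolants therefore differ by at
most `(1/2 + θ) θ^k L`, and the geometric series gives the last term of `C`. The other two terms are
the error of the level 0 interpolant.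

The geometric part proves the two estimates. The sets `distAvg` increase with `x`, and their measure
is continuous in `x` wherever the zero set of `distFun` is null. By the Lebesgue density theorem
this holds for every `x ≠ 1/2` (`volume_level_eq_zero`). At `1/2` nullity is either assumed or
replaced by offsets, so the intermediate value theorem controls the measure. Sets in a chain are
compared, up to null sets, by their measures, so this yields bounds on symmetric differences. The
bounds add over the finitely many disjoint pieces of `A \ B`, and then over the two sides of `A ∩
B`. -/

variable {n : ℕ}

/-! ### Null level sets of distance functions. -/

/-- A subset `S` of the zero set of a Lipschitz function is null if at each of its points the
function grows at least linearly in some direction. -/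
theorem volume_eq_zero_of_linear_growth {f : E n → ℝ} {K : NNReal} (hf : LipschitzWith K f)
    {S : Set (E n)} (hS : MeasurableSet S) (hfS : ∀ p ∈ S, f p = 0)
    (hgrow : ∀ p ∈ S, ∃ v : E n, ∃ κ > 0, ∀ᶠ s in 𝓝[>] (0 : ℝ), κ * s ≤ |f (p + s • v)|) :
    volume S = 0 := by
  have hdens := fun k : ℕ => IsUnifLocDoublingMeasure.ae_tendsto_measure_inter_div
    (volume : Measure (E n)) S (k : ℝ)
  rw [← ae_all_iff] at hdens
  have hfalse : ∀ᵐ x ∂(volume.restrict S), False := by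
    filter_upwards [hdens, ae_restrict_mem hS] with p hp hpS
    obtain ⟨v, κ, hκ, hev⟩ := hgrow p hpS
    -- On a ball of radius `η * s` about `p + s • v`, the Lipschitz bound changes `f` by less than
    -- `κ * s`, so the ball misses `S`. These balls are not centred at `p`, but `p` lies in their
    -- `k`-fold dilates, so the density theorem still applies. The limit density 0 contradicts
    -- density 1.
    have hη : 0 < κ / (K + 1) / 2 := by positivity
    set η := κ / (K + 1) / 2 with hηdef
    obtain ⟨k, hk⟩ := exists_nat_ge (‖v‖ / η)
    rw [div_le_iff₀ hη] at hk
    have hlim := hp k (l := 𝓝[>] (0 : ℝ)) (fun s => p + s • v) (fun s => η * s) ?_ ?_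
    · have h0 : Tendsto (fun s : ℝ => volume (S ∩ Metric.closedBall (p + s • v) (η * s)) /
          volume (Metric.closedBall (p + s • v) (η * s))) (𝓝[>] 0) (𝓝 0) := by
        refine tendsto_const_nhds.congr' ?_
        filter_upwards [hev, self_mem_nhdsWithin] with s hs hs0
        have hs0 : 0 < s := hs0
        have : S ∩ Metric.closedBall (p + s • v) (η * s) = ∅ := by
          refine eq_empty_of_forall_notMem fun q hq => ?_
          have h1 := hf.dist_le_mul (p + s • v) q
          rw [hfS q hq.1, Real.dist_eq, sub_zero] at h1
          have h2 : dist (p + s • v) q ≤ η * s := by rw [dist_comm]; exact hq.2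
          have h3 : (K : ℝ) * dist (p + s • v) q ≤ K * (η * s) := by gcongr
          have h4 : (K + 1) * η = κ / 2 := by rw [hηdef]; field_simp
          have h5 : 0 < η * s := by positivity
          have h6 : 0 < κ * s := by positivity
          have h7 : (K + 1) * (η * s) = κ * s / 2 := by rw [← mul_assoc, h4]; ring
          linarith
        simp [this]
      exact zero_ne_one (tendsto_nhds_unique h0 hlim)
    · refine tendsto_nhdsWithin_iff.2 ⟨?_, ?_⟩
      · have : Tendsto (fun s : ℝ => η * s) (𝓝 0) (𝓝 (η * 0)) :=
          (continuous_const.mul continuous_id).tendsto 0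
        rw [mul_zero] at this
        exact this.mono_left nhdsWithin_le_nhds
      · filter_upwards [self_mem_nhdsWithin] with s hs0
        exact mul_pos hη hs0
    · filter_upwards [self_mem_nhdsWithin] with s hs0
      have hs0 : 0 < s := hs0
      rw [Metric.mem_closedBall, dist_eq_norm]
      simp only [sub_add_cancel_left, norm_neg, norm_smul, Real.norm_eq_abs, abs_of_pos hs0]
      nlinarith
  simpa [Filter.eventually_false_iff_eq_bot] using hfalse

/-- Moving towards a nearest point of `F` decreases the distance to `F` at unit speed. -/
theorem infDist_add_smul {F : Set (E n)} {p y : E n} (hy : y ∈ F)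
    (hpy : Metric.infDist p F = dist p y) (hpos : 0 < dist p y) {s : ℝ} (hs0 : 0 ≤ s)
    (hs : s ≤ dist p y) :
    Metric.infDist (p + s • ((dist p y)⁻¹ • (y - p))) F = Metric.infDist p F - s := by
  have hv : ‖(dist p y)⁻¹ • (y - p)‖ = 1 := by
    rw [norm_smul, norm_inv, Real.norm_eq_abs, abs_of_pos hpos, dist_comm, dist_eq_norm]
    rw [dist_comm, dist_eq_norm] at hpos
    exact inv_mul_cancel₀ hpos.ne'
  apply le_antisymm
  · refine (Metric.infDist_le_dist_of_mem hy).trans ?_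
    have : p + s • ((dist p y)⁻¹ • (y - p)) - y = (s * (dist p y)⁻¹ - 1) • (y - p) := by
      rw [sub_smul, mul_smul]; simp only [one_smul]; abel
    rw [dist_eq_norm, this, norm_smul, ← dist_eq_norm y p, dist_comm y p, hpy, Real.norm_eq_abs,
      abs_of_nonpos]
    · apply le_of_eq; field_simp; ring
    · rw [sub_nonpos, ← div_eq_mul_inv, div_le_one hpos]; exact hs
  · have := Metric.infDist_le_infDist_add_dist (s := F) (x := p)
      (y := p + s • ((dist p y)⁻¹ • (y - p)))
    rw [dist_eq_norm p (p + _), sub_add_cancel_left, norm_neg, norm_smul, hv, Real.norm_eq_abs,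
      abs_of_nonneg hs0] at this
    linarith

theorem lipschitzWith_combination (F₁ F₂ : Set (E n)) (α β : ℝ) :
    LipschitzWith (‖α‖₊ * 1 + ‖β‖₊ * 1)
      (fun p => α * Metric.infDist p F₁ + β * Metric.infDist p F₂) :=
  ((lipschitzWith_smul α).comp (Metric.lipschitz_infDist_pt F₁)).add
    ((lipschitzWith_smul β).comp (Metric.lipschitz_infDist_pt F₂))

/-- A step of length `s` towards a nearest point of `F₁` changes the first term by exactly `|α| * s`
and the second by at most `|β| * s`, so the growth rate is at least `|α| - |β|`. On `F₁` itself
there is no such direction. -/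
theorem volume_combination_eq_zero_aux {F₁ F₂ : Set (E n)} (h₁ : F₁.Nonempty) (hc₁ : IsClosed F₁)
    {α β : ℝ} (hαβ : |β| < |α|) :
    volume ({p | α * Metric.infDist p F₁ + β * Metric.infDist p F₂ = 0} \ F₁) = 0 := by
  have hlip := lipschitzWith_combination F₁ F₂ α β
  refine volume_eq_zero_of_linear_growth hlip ?_ (fun p hp => hp.1) ?_
  · exact (hlip.continuous.measurable (measurableSet_singleton 0)).diff hc₁.measurableSet
  rintro p ⟨hp, hpF⟩
  obtain ⟨y, hy, hpy⟩ := hc₁.exists_infDist_eq_dist h₁ p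
  have hpos : 0 < dist p y := dist_pos.2 (by rintro rfl; exact hpF hy)
  refine ⟨(dist p y)⁻¹ • (y - p), |α| - |β|, by linarith, ?_⟩
  filter_upwards [Ioo_mem_nhdsGT hpos] with s hs
  rw [infDist_add_smul hy hpy hpos hs.1.le hs.2.le]
  have hv : ‖(dist p y)⁻¹ • (y - p)‖ = 1 := by
    rw [norm_smul, norm_inv, Real.norm_eq_abs, abs_of_pos hpos, ← dist_eq_norm, dist_comm y]
    exact inv_mul_cancel₀ hpos.ne'
  have h2 := (Metric.lipschitz_infDist_pt F₂).dist_le_mul (p + s • ((dist p y)⁻¹ • (y - p))) p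
  rw [dist_eq_norm (p + _), add_sub_cancel_left, norm_smul, hv, Real.norm_eq_abs,
    abs_of_pos hs.1, Real.dist_eq] at h2
  set d := Metric.infDist (p + s • ((dist p y)⁻¹ • (y - p))) F₂
  have hp : α * Metric.infDist p F₁ + β * Metric.infDist p F₂ = 0 := hp
  have e : α * (Metric.infDist p F₁ - s) + β * d
      = β * (d - Metric.infDist p F₂) - α * s := by linear_combination hp
  rw [e]
  have h3 : |β * (d - Metric.infDist p F₂)| ≤ |β| * s := by
    rw [abs_mul]; gcongr; simpa using h2
  have h4 : |α * s| = |α| * s := by rw [abs_mul, abs_of_pos hs.1]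
  have h5 := abs_sub_abs_le_abs_sub (α * s) (β * (d - Metric.infDist p F₂))
  rw [abs_sub_comm] at h5
  linarith

theorem volume_combination_eq_zero {F₁ F₂ : Set (E n)} (h₁ : F₁.Nonempty) (hc₁ : IsClosed F₁)
    (hn₁ : volume F₁ = 0) (h₂ : F₂.Nonempty) (hc₂ : IsClosed F₂) (hn₂ : volume F₂ = 0)
    {α β : ℝ} (hαβ : |α| ≠ |β|) :
    volume {p | α * Metric.infDist p F₁ + β * Metric.infDist p F₂ = 0} = 0 := by
  rcases lt_or_gt_of_ne hαβ with h | h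
  · have := volume_combination_eq_zero_aux (F₂ := F₁) h₂ hc₂ h
    rw [measure_sdiff_null hn₂] at this
    simpa only [add_comm] using this
  · have := volume_combination_eq_zero_aux (F₂ := F₂) h₁ hc₁ h
    rwa [measure_sdiff_null hn₁] at this

/-- Positivity of `r` matters: for `r = 0` the set is `F`, which may have positive measure. -/
theorem volume_infDist_eq {F : Set (E n)} (hF : F.Nonempty) (hc : IsClosed F) {r : ℝ}
    (hr : 0 < r) : volume {p | Metric.infDist p F = r} = 0 := by
  have hlip : LipschitzWith 1 (fun p => Metric.infDist p F - r) := by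
    simpa using (Metric.lipschitz_infDist_pt F).sub (LipschitzWith.const r)
  refine volume_eq_zero_of_linear_growth hlip ?_ (fun p hp => sub_eq_zero.2 hp) ?_
  · exact (Metric.continuous_infDist_pt F).measurable (measurableSet_singleton r)
  intro p hp
  obtain ⟨y, hy, hpy⟩ := hc.exists_infDist_eq_dist hF p
  have hp : Metric.infDist p F = r := hp
  have hpos : 0 < dist p y := by rw [← hpy, hp]; exact hr
  refine ⟨(dist p y)⁻¹ • (y - p), 1, one_pos, ?_⟩
  filter_upwards [Ioo_mem_nhdsGT hpos] with s hs
  rw [infDist_add_smul hy hpy hpos hs.1.le hs.2.le, hp, sub_right_comm, sub_self, zero_sub,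
    abs_neg, abs_of_pos hs.1, one_mul]

/-! ### Signed distances and centers. -/

theorem frontier_nonempty (hn : 0 < n) {A : Set (E n)} (hA : A.Nonempty)
    (hb : Bornology.IsBounded A) : (frontier A).Nonempty := by
  have : NeZero n := ⟨hn.ne'⟩
  rw [nonempty_frontier_iff]
  refine ⟨hA, ?_⟩
  rintro rfl
  exact NormedSpace.unbounded_univ ℝ (E n) hb

theorem infDist_frontier_of_mem {A : Set (E n)} (hA : A ≠ univ) {p : E n} (hp : p ∈ A) :
    Metric.infDist p (frontier A) = Metric.infDist p Aᶜ := by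
  obtain ⟨y, hy, hpy⟩ := exists_mem_frontier_infDist_compl_eq_dist hp hA
  refine le_antisymm (hpy ▸ Metric.infDist_le_dist_of_mem hy) ?_
  rw [← Metric.infDist_closure (s := Aᶜ)]
  refine Metric.infDist_le_infDist_of_subset ?_ ⟨y, hy⟩
  rw [← frontier_compl]
  exact frontier_subset_closure

/-- This form, without cases, makes both continuity in `p` and monotonicity in `A` evident. -/
theorem signedDist_eq {A : Set (E n)} (hA : A.Nonempty) (hA' : A ≠ univ) (p : E n) :
    signedDist p A = Metric.infDist p Aᶜ - Metric.infDist p A := by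
  unfold signedDist
  split_ifs with hp
  · rw [infDist_frontier_of_mem hA' hp, Metric.infDist_zero_of_mem hp, sub_zero]
  · have : Aᶜ ≠ univ := by simpa using hA.ne_empty
    rw [← frontier_compl, infDist_frontier_of_mem this hp, compl_compl,
      Metric.infDist_zero_of_mem (s := Aᶜ) hp, zero_sub]

theorem continuous_signedDist {A : Set (E n)} (hA : A.Nonempty) (hA' : A ≠ univ) :
    Continuous (fun p => signedDist p A) := by
  simp only [signedDist_eq hA hA']
  exact (Metric.continuous_infDist_pt _).sub (Metric.continuous_infDist_pt _)

theorem signedDist_mono {A B : Set (E n)} (hB : B.Nonempty) (hA' : A ≠ univ) (h : B ⊆ A)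
    (p : E n) : signedDist p B ≤ signedDist p A := by
  have hB' : B ≠ univ := by rintro rfl; exact hA' (univ_subset_iff.1 h)
  rw [signedDist_eq hB hB', signedDist_eq (hB.mono h) hA']
  have h1 := Metric.infDist_le_infDist_of_subset (x := p) h hB
  have h2 := Metric.infDist_le_infDist_of_subset (x := p) (compl_subset_compl.2 h)
    (nonempty_compl.2 hA')
  linarith

theorem signedDist_nonneg_iff {A : Set (E n)} (hA : (frontier A).Nonempty) (p : E n) :
    0 ≤ signedDist p A ↔ p ∈ closure A := by
  unfold signedDist
  split_ifs with hp
  · simp [Metric.infDist_nonneg, subset_closure hp]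
  · have h0 : Metric.infDist p (frontier A) ≤ 0 ↔ p ∈ frontier A := by
      rw [isClosed_frontier.mem_iff_infDist_zero hA]
      exact ⟨fun h => le_antisymm h Metric.infDist_nonneg, fun h => h.le⟩
    rw [Left.nonneg_neg_iff, h0]
    exact ⟨fun h => h.1, fun h => ⟨h, fun h' => hp (interior_subset h')⟩⟩

theorem abs_signedDist (p : E n) (A : Set (E n)) :
    |signedDist p A| = Metric.infDist p (frontier A) := by
  unfold signedDist
  split_ifs <;> simp [abs_of_nonneg Metric.infDist_nonneg]

/-- The points equidistant from the boundary and from a center form a null set. -/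
theorem volume_equidistant_center (hn : 0 < n) {A : Set (E n)} (hA : A.Nonempty)
    (hb : Bornology.IsBounded A) {q : E n} (hq : IsCenter A q) :
    volume {p | p ∈ A ∧ Metric.infDist p (frontier A) = dist p q} = 0 := by
  have : NeZero n := ⟨hn.ne'⟩
  have hfr := frontier_nonempty hn hA hb
  have hmax : ∀ p ∈ A, Metric.infDist p (frontier A) ≤ Metric.infDist q (frontier A) := by
    intro p hp
    simpa [signedDist, hp, hq.1] using hq.2 p hp
  -- If the deepest point has depth zero, every point of `A` does, and only `q` itself is
  -- equidistant.
  by_cases hqf : q ∈ frontier A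
  · refine measure_mono_null (t := {q}) ?_ (measure_singleton q)
    rintro p ⟨hp, hpq⟩
    have := hmax p hp
    rw [hpq, Metric.infDist_zero_of_mem hqf] at this
    exact dist_le_zero.1 this
  have hlip : LipschitzWith (1 + 1) (fun p => Metric.infDist p (frontier A) - dist p q) :=
    (Metric.lipschitz_infDist_pt _).sub (LipschitzWith.dist_left q)
  refine measure_mono_null (t := ({p | Metric.infDist p (frontier A) - dist p q = 0} \ {q}) ∪ {q})
    ?_ (measure_union_null ?_ (measure_singleton q))
  · rintro p ⟨hp, hpq⟩
    by_cases h : p = q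
    · exact Or.inr h
    · exact Or.inl ⟨sub_eq_zero.2 hpq, h⟩
  refine volume_eq_zero_of_linear_growth hlip ?_ (fun p hp => hp.1) ?_
  · exact (hlip.continuous.measurable (measurableSet_singleton 0)).diff (measurableSet_singleton q)
  rintro p ⟨hp, hpq⟩
  have hp : Metric.infDist p (frontier A) = dist p q := sub_eq_zero.1 hp
  obtain ⟨y, hy, hpy⟩ := isClosed_frontier.exists_infDist_eq_dist hfr p
  have hR : 0 < dist p q := dist_pos.2 hpq
  have hyq : y ≠ q := by rintro rfl; exact hqf hy
  have hpos : 0 < dist p y := by rwa [← hpy, hp]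
  have hyR : dist p y = dist p q := by rw [← hpy, hp]
  -- Both distances now carry the same weight, so neither dominates. Since `y` and `q` are distinct
  -- points of one sphere about `p`, the inner product is strictly below the squared radius: moving
  -- towards `y` reduces the distance to `q` more slowly than the distance to the frontier.
  have hin : inner ℝ (y - p) (q - p) < dist p q ^ 2 := by
    have h1 := norm_sub_sq_real (y - p) (q - p)
    rw [← dist_eq_norm y p, ← dist_eq_norm q p, dist_comm y p, dist_comm q p, hyR] at h1
    have h2 : 0 < ‖(y - p) - (q - p)‖ := by
      rw [sub_sub_sub_cancel_right]; exact norm_pos_iff.2 (sub_ne_zero.2 hyq)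
    nlinarith
  refine ⟨(dist p y)⁻¹ • (y - p), 1 - inner ℝ (y - p) (q - p) / dist p q ^ 2, ?_, ?_⟩
  · rw [gt_iff_lt, sub_pos, div_lt_one (by positivity)]; exact hin
  filter_upwards [Ioo_mem_nhdsGT hpos] with s hs
  rw [infDist_add_smul hy hpy hpos hs.1.le hs.2.le, hp]
  have h1 : inner ℝ (p + s • ((dist p y)⁻¹ • (y - p)) - q) (p - q) ≤
      dist (p + s • ((dist p y)⁻¹ • (y - p))) q * dist p q := by
    rw [dist_eq_norm, dist_eq_norm]; exact real_inner_le_norm _ _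
  have h2 : inner ℝ (p + s • ((dist p y)⁻¹ • (y - p)) - q) (p - q) =
      dist p q ^ 2 - s * (dist p q)⁻¹ * inner ℝ (y - p) (q - p) := by
    have : p + s • ((dist p y)⁻¹ • (y - p)) - q
        = (p - q) + (s * (dist p q)⁻¹) • (y - p) := by rw [hyR, mul_smul]; abel
    rw [this, inner_add_left, real_inner_self_eq_norm_sq, ← dist_eq_norm, inner_smul_left,
      ← neg_sub q p, inner_neg_right]
    simp; ring
  set d := dist (p + s • ((dist p y)⁻¹ • (y - p))) q
  set c := inner ℝ (y - p) (q - p)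
  set R := dist p q
  have h3 : R - s * (c / R ^ 2) ≤ d := by
    rw [h2] at h1
    have : R ^ 2 - s * R⁻¹ * c = (R - s * (c / R ^ 2)) * R := by field_simp
    rw [this] at h1
    exact le_of_mul_le_mul_right h1 hR
  rw [abs_sub_comm]
  refine le_trans ?_ (le_abs_self _)
  linarith

/-! ### Bounded sets with null boundary, and regularization by `ci`. -/

/-- Bounded sets whose boundary is a null set. -/
structure IsJordan (A : Set (E n)) : Prop where
  bounded : Bornology.IsBounded A
  null : volume (frontier A) = 0

namespace IsJordan

variable {A B : Set (E n)}

theorem of_mem (hA : A ∈ JSets n) : IsJordan A := ⟨hA.1, hA.2.2⟩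

theorem nullMeasurableSet (hA : IsJordan A) : NullMeasurableSet A volume :=
  nullMeasurableSet_of_null_frontier hA.null

theorem ne_top (hA : IsJordan A) : volume A ≠ ⊤ := hA.bounded.measure_lt_top.ne

theorem union (hA : IsJordan A) (hB : IsJordan B) : IsJordan (A ∪ B) := by
  refine ⟨hA.bounded.union hB.bounded, measure_mono_null (t := frontier A ∪ frontier B) ?_
    (measure_union_null hA.null hB.null)⟩
  exact (frontier_union_subset A B).trans
    (union_subset_union inter_subset_left inter_subset_right)

theorem inter (hA : IsJordan A) (hB : IsJordan B) : IsJordan (A ∩ B) := by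
  refine ⟨hA.bounded.subset inter_subset_left, measure_mono_null (t := frontier A ∪ frontier B) ?_
    (measure_union_null hA.null hB.null)⟩
  exact (frontier_inter_subset A B).trans
    (union_subset_union inter_subset_left inter_subset_right)

theorem diff (hA : IsJordan A) (hB : IsJordan B) : IsJordan (A \ B) := by
  refine ⟨hA.bounded.subset sdiff_subset, measure_mono_null (t := frontier A ∪ frontier Bᶜ) ?_
    (measure_union_null hA.null (by rw [frontier_compl]; exact hB.null))⟩
  exact (frontier_inter_subset A Bᶜ).trans
    (union_subset_union inter_subset_left inter_subset_right)

theorem biInter {ι : Type*} {s : Set ι} (hs : s.Finite) (hne : s.Nonempty) {f : ι → Set (E n)}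
    (h : ∀ i ∈ s, IsJordan (f i)) : IsJordan (⋂ i ∈ s, f i) := by
  induction s, hs using Set.Finite.induction_on with
  | empty => simp at hne
  | @insert a s _ _ ih =>
    rw [biInter_insert]
    rcases s.eq_empty_or_nonempty with rfl | hs'
    · simpa using h _ (mem_insert _ _)
    · exact (h _ (mem_insert _ _)).inter (ih hs' fun i hi => h i (mem_insert_of_mem _ hi))

theorem interior_ae_eq (hA : IsJordan A) : interior A =ᵐ[volume] A :=
  interior_ae_eq_of_null_frontier hA.null

theorem ci_ae_eq (hA : IsJordan A) : ci A =ᵐ[volume] A := by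
  have h1 : closure A =ᵐ[volume] A := closure_ae_eq_of_null_frontier hA.null
  refine Filter.EventuallyLE.antisymm ?_ ?_
  · exact (closure_mono interior_subset).eventuallyLE.trans h1.le
  · exact hA.interior_ae_eq.symm.le.trans subset_closure.eventuallyLE

theorem ci_mem (hA : IsJordan A) : ci A ∈ JSets n := by
  refine ⟨hA.bounded.closure.subset (closure_mono interior_subset), ?_, ?_⟩
  · refine subset_antisymm ?_ ?_
    · exact closure_minimal interior_subset isClosed_closure
    · exact closure_mono (interior_maximal subset_closure isOpen_interior)
  · refine measure_mono_null ?_ hA.null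
    unfold ci
    rw [isClosed_closure.frontier_eq]
    rintro p ⟨h1, h2⟩
    exact ⟨closure_mono interior_subset h1,
      fun h => h2 (interior_maximal subset_closure isOpen_interior h)⟩

/-- The set `interior A \ D` is open and null, hence empty. So `D` lies between `interior A` and
`closure A`, and its frontier lies in that of `A`. No information on level sets is needed. -/
theorem of_isClosed {D : Set (E n)} (hA : IsJordan A) (hDA : D ⊆ closure A) (hD : IsClosed D)
    (h : volume (A \ D) = 0) : IsJordan D := by
  refine ⟨hA.bounded.closure.subset hDA, measure_mono_null ?_ hA.null⟩
  have hint : interior A ⊆ D := by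
    rw [← sdiff_eq_empty]
    refine (isOpen_interior.sdiff hD).eq_empty_of_measure_zero
      (measure_mono_null (sdiff_subset_sdiff_left interior_subset) h)
  rw [hD.frontier_eq]
  exact fun p hp => ⟨hDA hp.1, fun h' => hp.2 (interior_maximal hint isOpen_interior h')⟩

theorem of_subset_closed {D : Set (E n)} (hb : Bornology.IsBounded D) (hA : IsJordan A)
    (hAD : A ⊆ D) (hD : IsClosed D) (h : volume (D \ A) = 0) : IsJordan D := by
  refine ⟨hb, measure_mono_null (t := frontier A ∪ D \ A) ?_ (measure_union_null hA.null h)⟩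
  rw [hD.frontier_eq]
  intro p hp
  by_cases hpA : p ∈ A
  · exact Or.inl ⟨subset_closure hpA, fun h' => hp.2 (interior_mono hAD h')⟩
  · exact Or.inr ⟨hp.1, hpA⟩

/-- The measure of a difference, up to null sets. -/
theorem real_diff (hA : IsJordan A) (hB : IsJordan B) (h : volume (A \ B) = 0) :
    volume.real (B \ A) = volume.real B - volume.real A := by
  have h1 := measureReal_inter_add_sdiff₀ (μ := volume) (s := B) hA.nullMeasurableSet hB.ne_top
  have h2 : volume.real (B ∩ A) = volume.real A := by
    have h3 := measureReal_inter_add_sdiff₀ (μ := volume) (s := A) hB.nullMeasurableSet hA.ne_top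
    rw [measureReal_def (s := A \ B), h, ENNReal.toReal_zero, add_zero, inter_comm] at h3
    exact h3
  linarith

end IsJordan

theorem isClosed_of_mem_JSets {A : Set (E n)} (hA : A ∈ JSets n) : IsClosed A := by
  rw [← hA.2.1]; exact isClosed_closure

theorem union_mem_JSets {A B : Set (E n)} (hA : A ∈ JSets n) (hB : B ∈ JSets n) :
    A ∪ B ∈ JSets n := by
  have hJ := (IsJordan.of_mem hA).union (IsJordan.of_mem hB)
  refine ⟨hJ.bounded, subset_antisymm ?_ ?_, hJ.null⟩
  · exact closure_minimal interior_subset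
      ((isClosed_of_mem_JSets hA).union (isClosed_of_mem_JSets hB))
  · refine union_subset ?_ ?_
    · conv_lhs => rw [← hA.2.1]
      exact closure_mono (interior_mono subset_union_left)
    · conv_lhs => rw [← hB.2.1]
      exact closure_mono (interior_mono subset_union_right)

theorem empty_mem_JSets : (∅ : Set (E n)) ∈ JSets n :=
  ⟨Bornology.isBounded_empty, by simp [ci], by simp⟩

theorem biUnion_mem_JSets {ι : Type*} {s : Set ι} (hs : s.Finite) {f : ι → Set (E n)}
    (h : ∀ i ∈ s, f i ∈ JSets n) : (⋃ i ∈ s, f i) ∈ JSets n := by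
  induction s, hs using Set.Finite.induction_on with
  | empty => simpa using empty_mem_JSets
  | insert _ _ ih =>
    rw [biUnion_insert]
    exact union_mem_JSets (h _ (mem_insert _ _)) (ih fun i hi => h i (mem_insert_of_mem _ hi))

/-! ### Distance averages of a simple pair: monotonicity, boundedness and measure. -/

open Classical in
/-- The function with weight `1 - x` in `distFun center A B x`. -/
def lowerFun (c : Set (E n) → E n) (A B : Set (E n)) (p : E n) : ℝ :=
  if B = ∅ then -dist p (c A) else signedDist p B

theorem distFun_eq (c : Set (E n) → E n) (A B : Set (E n)) (x : ℝ) (p : E n) :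
    distFun c A B x p = x * signedDist p A + (1 - x) * lowerFun c A B p := by
  unfold distFun lowerFun
  split_ifs
  · rw [dist_eq_norm]; ring
  · rfl

theorem distAvg_zero_of_empty {c : Set (E n) → E n} {A B : Set (E n)} (hB : B = ∅) :
    distAvg c A B 0 = {c A} := by
  ext p
  simp [distAvg, distFun_eq, lowerFun, hB]

/-- The pairs of sets to which the simple average is applied. -/
structure IsSimplePair (c : Set (E n) → E n) (A B : Set (E n)) : Prop where
  pos : 0 < n
  nonempty : A.Nonempty
  upper : IsJordan A
  lower : IsJordan B
  closed : IsClosed B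
  subset : B ⊆ A
  center : IsCenter A (c A)

namespace IsSimplePair

variable {c : Set (E n) → E n} {A B : Set (E n)} (h : IsSimplePair c A B)
include h

theorem frontier_upper_nonempty : (frontier A).Nonempty :=
  frontier_nonempty h.pos h.nonempty h.upper.bounded

theorem upper_ne_univ : A ≠ univ := by
  rintro rfl
  simpa using h.frontier_upper_nonempty

theorem lower_ne_univ : B ≠ univ := by
  rintro rfl
  exact h.upper_ne_univ (univ_subset_iff.1 h.subset)

theorem frontier_lower_nonempty (hB : B.Nonempty) : (frontier B).Nonempty :=
  frontier_nonempty h.pos hB h.lower.bounded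

theorem continuous_lowerFun : Continuous (lowerFun c A B) := by
  rcases B.eq_empty_or_nonempty with rfl | hB
  · have : lowerFun c A ∅ = fun p => -dist p (c A) := by funext p; simp [lowerFun]
    rw [this]
    fun_prop
  · have : lowerFun c A B = fun p => signedDist p B := by
      funext p; simp [lowerFun, hB.ne_empty]
    rw [this]
    exact continuous_signedDist hB h.lower_ne_univ

theorem continuous_distFun (x : ℝ) : Continuous (distFun c A B x) := by
  have : distFun c A B x = fun p => x * signedDist p A + (1 - x) * lowerFun c A B p :=
    funext (distFun_eq c A B x)
  rw [this]
  exact (continuous_const.mul (continuous_signedDist h.nonempty h.upper_ne_univ)).add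
    (continuous_const.mul h.continuous_lowerFun)

/-- This inequality makes `distFun` increasing in `x`, so the distance averages form a chain. For `B
= ∅` it holds because the center belongs to `A`. -/
theorem lowerFun_le (p : E n) : lowerFun c A B p ≤ signedDist p A := by
  unfold lowerFun
  split_ifs with hB
  · rw [signedDist_eq h.nonempty h.upper_ne_univ]
    have h1 := Metric.infDist_le_dist_of_mem (x := p) h.center.1
    have h2 : 0 ≤ Metric.infDist p Aᶜ := Metric.infDist_nonneg
    linarith
  · exact signedDist_mono (nonempty_iff_ne_empty.2 hB) h.upper_ne_univ h.subset p

theorem distFun_mono (p : E n) {x y : ℝ} (hxy : x ≤ y) :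
    distFun c A B x p ≤ distFun c A B y p := by
  rw [distFun_eq, distFun_eq]
  nlinarith [h.lowerFun_le p]

theorem distAvg_mono {x y : ℝ} (hxy : x ≤ y) : distAvg c A B x ⊆ distAvg c A B y :=
  fun p hp => le_trans hp (h.distFun_mono p hxy)

theorem isClosed_distAvg (x : ℝ) : IsClosed (distAvg c A B x) :=
  isClosed_le continuous_const (h.continuous_distFun x)

theorem frontier_distAvg_subset (x : ℝ) :
    frontier (distAvg c A B x) ⊆ {p | distFun c A B x p = 0} :=
  fun _ hp => (frontier_le_subset_eq continuous_const (h.continuous_distFun x) hp).symm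

/-- If `A` lies in the ball of radius `R` and `‖p‖ > R`, both functions being combined lie in
`[-(‖p‖ + R), -(‖p‖ - R)]`. They differ by at most `2 * R`, so the combination is negative once `‖p‖
> R + |x| * (2 * R)`. -/
theorem isBounded_distAvg (x : ℝ) : Bornology.IsBounded (distAvg c A B x) := by
  obtain ⟨R, hR⟩ := h.upper.bounded.subset_closedBall 0
  refine (Metric.isBounded_closedBall (x := (0 : E n)) (r := R + |x| * (2 * R))).subset ?_
  have hR0 : 0 ≤ R := by
    obtain ⟨a, ha⟩ := h.nonempty
    exact (norm_nonneg a).trans (by simpa using hR ha)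
  have key : ∀ S : Set (E n), S.Nonempty → S ⊆ A → ∀ p : E n, R < ‖p‖ →
      ‖p‖ - R ≤ Metric.infDist p S ∧ Metric.infDist p S ≤ ‖p‖ + R := by
    intro S hS hSA p hp
    constructor
    · rw [Metric.le_infDist hS]
      intro y hy
      have h1 : ‖y‖ ≤ R := by simpa using hR (hSA hy)
      have h2 := norm_sub_norm_le p y
      rw [dist_eq_norm]; linarith
    · obtain ⟨y, hy⟩ := hS
      have h1 : ‖y‖ ≤ R := by simpa using hR (hSA hy)
      refine (Metric.infDist_le_dist_of_mem hy).trans ?_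
      rw [dist_eq_norm]
      exact (norm_sub_le p y).trans (by linarith)
  have hsd : ∀ S : Set (E n), S.Nonempty → S ⊆ A → S ≠ univ → ∀ p : E n, R < ‖p‖ →
      signedDist p S = -Metric.infDist p S := by
    intro S hS hSA hSu p hp
    have hpS : p ∉ S := fun hpS => by
      have : ‖p‖ ≤ R := by simpa using hR (hSA hpS)
      linarith
    rw [signedDist_eq hS hSu, Metric.infDist_zero_of_mem (s := Sᶜ) hpS, zero_sub]
  intro p hp
  by_contra hcon
  rw [mem_closedBall_zero_iff, not_le] at hcon
  have h0 : 0 ≤ |x| * (2 * R) := by positivity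
  have hpR : R < ‖p‖ := by linarith
  have hu1 := key A h.nonempty subset_rfl p hpR
  have hl : -(‖p‖ + R) ≤ lowerFun c A B p ∧ lowerFun c A B p ≤ -(‖p‖ - R) := by
    unfold lowerFun
    split_ifs with hB
    · have := key {c A} (singleton_nonempty _) (singleton_subset_iff.2 h.center.1) p hpR
      rw [Metric.infDist_singleton] at this
      constructor <;> linarith
    · have hB := nonempty_iff_ne_empty.2 hB
      have := key B hB h.subset p hpR
      rw [hsd B hB h.subset h.lower_ne_univ p hpR]
      constructor <;> linarith
  have hp : 0 ≤ distFun c A B x p := hp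
  have hp' := hp.trans (h.distFun_mono p (le_abs_self x))
  rw [distFun_eq, hsd A h.nonempty subset_rfl h.upper_ne_univ p hpR] at hp'
  nlinarith [abs_nonneg x, mul_le_mul_of_nonneg_left
    (show -Metric.infDist p A - lowerFun c A B p ≤ 2 * R by linarith) (abs_nonneg x)]

theorem distAvg_one : distAvg c A B 1 = closure A := by
  ext p
  rw [← signedDist_nonneg_iff h.frontier_upper_nonempty]
  simp [distAvg, distFun_eq]

theorem distAvg_zero_of_nonempty (hB : B.Nonempty) : distAvg c A B 0 = B := by
  ext p
  conv_rhs => rw [← h.closed.closure_eq, ← signedDist_nonneg_iff (h.frontier_lower_nonempty hB)]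
  simp [distAvg, distFun_eq, lowerFun, hB.ne_empty]

theorem distAvg_one_ae_eq : distAvg c A B 1 =ᵐ[volume] A := by
  rw [h.distAvg_one]
  exact closure_ae_eq_of_null_frontier h.upper.null

/-- For `B = ∅` the average at `0` is the single point `c A`, which is null since `n > 0`; equality
holds only almost everywhere. -/
theorem distAvg_zero_ae_eq : distAvg c A B 0 =ᵐ[volume] B := by
  have : NeZero n := ⟨h.pos.ne'⟩
  rcases B.eq_empty_or_nonempty with hB | hB
  · rw [SetSubdivision.distAvg_zero_of_empty hB, hB, ae_eq_empty]
    exact measure_singleton _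
  · exact (h.distAvg_zero_of_nonempty hB).eventuallyEq

/-- The weights have equal absolute value only at `x = 1/2`. Passing to absolute values leaves two
combinations of distances, one for each relative sign of the two functions. -/
theorem volume_level_eq_zero {x : ℝ} (hx : x ≠ 1 / 2) :
    volume {p | distFun c A B x p = 0} = 0 := by
  have : NeZero n := ⟨h.pos.ne'⟩
  obtain ⟨F, hF, hFc, hF0, hFl⟩ : ∃ F : Set (E n), F.Nonempty ∧ IsClosed F ∧ volume F = 0 ∧
      ∀ p, |lowerFun c A B p| = Metric.infDist p F := by
    rcases B.eq_empty_or_nonempty with hB | hB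
    · refine ⟨{c A}, singleton_nonempty _, isClosed_singleton, measure_singleton _, fun p => ?_⟩
      simp [lowerFun, hB, Metric.infDist_singleton]
    · refine ⟨frontier B, h.frontier_lower_nonempty hB, isClosed_frontier, h.lower.null,
        fun p => ?_⟩
      simp [lowerFun, hB.ne_empty, abs_signedDist]
  have hne : |x| ≠ |1 - x| := by
    intro he
    rcases abs_eq_abs.1 he with h1 | h1
    · apply hx; linarith
    · linarith
  have h1 := volume_combination_eq_zero h.frontier_upper_nonempty isClosed_frontier h.upper.null
    hF hFc hF0 hne
  have h2 := volume_combination_eq_zero h.frontier_upper_nonempty isClosed_frontier h.upper.null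
    hF hFc hF0 (show |x| ≠ |-(1 - x)| by rwa [abs_neg])
  refine measure_mono_null ?_ (measure_union_null h1 h2)
  intro p hp
  have hp : distFun c A B x p = 0 := hp
  rw [distFun_eq] at hp
  simp only [mem_union, mem_ofPred_eq, ← hFl, ← abs_signedDist]
  rcases abs_choice (signedDist p A) with h3 | h3 <;>
    rcases abs_choice (lowerFun c A B p) with h4 | h4 <;> rw [h3, h4]
  · left; linarith
  · right; linarith
  · right; linarith
  · left; linarith

/-- Consequently the offset construction is never applied to an empty `B`. -/
theorem zeroMeasureCond_of_empty (hB : B = ∅) : ZeroMeasureCond c A B := by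
  refine measure_mono_null ?_
    (volume_equidistant_center h.pos h.nonempty h.upper.bounded h.center)
  intro p hp
  have hp : distFun c A B (1 / 2) p = 0 := hp
  rw [distFun_eq, lowerFun, if_pos hB] at hp
  have hp : signedDist p A = dist p (c A) := by linarith
  have hpA : p ∈ A := by
    by_contra hpA
    rw [signedDist, if_neg hpA] at hp
    have h1 : 0 ≤ Metric.infDist p (frontier A) := Metric.infDist_nonneg
    have h2 : dist p (c A) ≤ 0 := by linarith
    rw [dist_le_zero.1 h2] at hpA
    exact hpA h.center.1
  rw [signedDist, if_pos hpA] at hp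
  exact ⟨hpA, hp⟩

theorem isJordan_distAvg {x : ℝ} (hx : volume {p | distFun c A B x p = 0} = 0) :
    IsJordan (distAvg c A B x) :=
  ⟨h.isBounded_distAvg x, measure_mono_null (h.frontier_distAvg_subset x) hx⟩

/-- Off the null level set, membership of a point is constant for parameters near `x`. Dominated
convergence then applies, with the average at `x + 1` as the bound. -/
theorem continuousAt_real_distAvg {x : ℝ} (hx : volume {p | distFun c A B x p = 0} = 0) :
    ContinuousAt (fun y => volume.real (distAvg c A B y)) x := by
  refine (ENNReal.tendsto_toReal (h.isBounded_distAvg x).measure_lt_top.ne).comp ?_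
  refine tendsto_measure_of_ae_tendsto_indicator (𝓝 x) (h.isClosed_distAvg x).measurableSet
    (fun y => (h.isClosed_distAvg y).measurableSet) (h.isClosed_distAvg (x + 1)).measurableSet
    (h.isBounded_distAvg (x + 1)).measure_lt_top.ne ?_ ?_
  · filter_upwards [Iio_mem_nhds (lt_add_one x)] with y hy
    exact h.distAvg_mono (le_of_lt hy)
  · have : ∀ᵐ p ∂(volume : Measure (E n)), distFun c A B x p ≠ 0 := by
      rw [ae_iff]; simpa using hx
    filter_upwards [this] with p hp
    have hcont : Continuous fun y => distFun c A B y p := by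
      simp only [distFun_eq]; fun_prop
    rcases lt_or_gt_of_ne hp with h1 | h1
    · filter_upwards [hcont.continuousAt.eventually_lt continuousAt_const h1] with y hy
      simp [distAvg, not_le.2 hy, not_le.2 h1]
    · filter_upwards [continuousAt_const.eventually_lt hcont.continuousAt h1] with y hy
      simp [distAvg, hy.le, h1.le]

theorem real_distAvg_mono : Monotone fun y => volume.real (distAvg c A B y) := fun _ y hxy =>
  measureReal_mono (h.distAvg_mono hxy) (h.isBounded_distAvg y).measure_lt_top.ne

theorem real_distAvg_one : volume.real (distAvg c A B 1) = volume.real A :=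
  measureReal_congr h.distAvg_one_ae_eq

theorem real_distAvg_zero : volume.real (distAvg c A B 0) = volume.real B :=
  measureReal_congr h.distAvg_zero_ae_eq

theorem real_lower_le : volume.real B ≤ volume.real A :=
  measureReal_mono h.subset h.upper.ne_top

/-- In a chain of sets of finite measure, an inequality of measures forces inclusion up to a null
set. It is applied with `x₀ = 0` or `1`, turning control of measures into control of differences. -/
theorem volume_diff_distAvg {S : Set (E n)} {x₀ x : ℝ} (hS : distAvg c A B x₀ =ᵐ[volume] S)
    (hx : volume.real S ≤ volume.real (distAvg c A B x)) : volume (S \ distAvg c A B x) = 0 := by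
  rw [← ae_le_set]
  refine hS.symm.le.trans ?_
  rcases le_total x₀ x with hle | hle
  · exact (h.distAvg_mono hle).eventuallyLE
  · refine (ae_eq_of_subset_of_measure_ge (h.distAvg_mono hle) ?_
      (h.isClosed_distAvg x).measurableSet.nullMeasurableSet
      (h.isBounded_distAvg x₀).measure_lt_top.ne).symm.le
    rw [← measureReal_congr hS] at hx
    exact (ENNReal.toReal_le_toReal (h.isBounded_distAvg x₀).measure_lt_top.ne
      (h.isBounded_distAvg x).measure_lt_top.ne).1 hx

theorem volume_distAvg_diff {S : Set (E n)} {x₀ x : ℝ} (hS : distAvg c A B x₀ =ᵐ[volume] S)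
    (hx : volume.real (distAvg c A B x) ≤ volume.real S) : volume (distAvg c A B x \ S) = 0 := by
  rw [← ae_le_set]
  refine Filter.EventuallyLE.trans ?_ hS.le
  rcases le_total x x₀ with hle | hle
  · exact (h.distAvg_mono hle).eventuallyLE
  · refine (ae_eq_of_subset_of_measure_ge (h.distAvg_mono hle) ?_
      (h.isClosed_distAvg x₀).measurableSet.nullMeasurableSet
      (h.isBounded_distAvg x).measure_lt_top.ne).symm.le
    rw [← measureReal_congr hS] at hx
    exact (ENNReal.toReal_le_toReal (h.isBounded_distAvg x).measure_lt_top.ne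
      (h.isBounded_distAvg x₀).measure_lt_top.ne).1 hx

theorem real_diff_eq : volume.real (A \ B) = volume.real A - volume.real B :=
  h.lower.real_diff h.upper (by simp [sdiff_eq_empty.2 h.subset])

omit h in
theorem targetMeasure_eq_upper (t : ℝ) : targetMeasure A B t =
    volume.real A + (t - 1) * (volume.real A - volume.real B) := by
  unfold targetMeasure; ring

omit h in
theorem targetMeasure_eq_lower (t : ℝ) : targetMeasure A B t =
    volume.real B + t * (volume.real A - volume.real B) := by
  unfold targetMeasure; ring

/-- The intermediate value theorem for the measure of distance averages. -/
theorem exists_real_distAvg_eq {a b v : ℝ} (hab : a ≤ b)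
    (hz : ∀ x ∈ Icc a b, volume {p | distFun c A B x p = 0} = 0)
    (ha : volume.real (distAvg c A B a) ≤ v) (hb : v ≤ volume.real (distAvg c A B b)) :
    ∃ x ∈ Icc a b, volume.real (distAvg c A B x) = v :=
  intermediate_value_Icc hab
    (fun x hx => (h.continuousAt_real_distAvg (hz x hx)).continuousWithinAt) ⟨ha, hb⟩

theorem reparam_inner {N t : ℝ} (hN : 1 < N) (hz : ZeroMeasureCond c A B) (ht : t ∈ Icc (0 : ℝ) 1) :
    (∃ x, IsReparam c N A B t x) ∧ ∀ g, IsReparam c N A B t g →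
      volume.real (distAvg c A B g) = targetMeasure A B t := by
  have hle := h.real_lower_le
  obtain ⟨x, hx, hxv⟩ := h.exists_real_distAvg_eq zero_le_one (v := targetMeasure A B t)
    (fun x _ => by
      by_cases hx : x = 1 / 2
      · rw [hx]; exact hz
      · exact h.volume_level_eq_zero hx)
    (by
      rw [h.real_distAvg_zero, targetMeasure_eq_lower]
      nlinarith [ht.1])
    (by
      rw [h.real_distAvg_one, targetMeasure_eq_upper]
      nlinarith [ht.2])
  have hxN : x ∈ Icc (-N) N := ⟨by linarith [hx.1], by linarith [hx.2]⟩
  refine ⟨⟨x, hxN, fun y _ => by rw [hxv]; simp⟩, fun g hg => ?_⟩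
  have := hg.2 x hxN
  rw [hxv, sub_self, abs_zero] at this
  exact sub_eq_zero.1 (abs_nonpos_iff.1 this)

/-- The bound `N` may keep the target out of reach, so only inequalities survive. Comparison with `x
= 1` gives the lower one. Overshooting the target would, by the intermediate value theorem,
contradict minimality. A minimizer over `[1, N]` is global because smaller parameters are no closer
to the target. -/
theorem reparam_gt {N t : ℝ} (hN : 1 < N) (ht : 1 < t) :
    (∃ x, IsReparam c N A B t x) ∧ ∀ g, IsReparam c N A B t g →
      volume.real A ≤ volume.real (distAvg c A B g) ∧
      volume.real (distAvg c A B g) ≤ targetMeasure A B t := by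
  have hle := h.real_lower_le
  have hc : volume.real A ≤ targetMeasure A B t := by
    rw [targetMeasure_eq_upper]; nlinarith
  have hz : ∀ x, 1 ≤ x → volume {p | distFun c A B x p = 0} = 0 :=
    fun x hx => h.volume_level_eq_zero (by linarith)
  have h1 := h.real_distAvg_one
  constructor
  · have hcont : ContinuousOn (fun x => |volume.real (distAvg c A B x) - targetMeasure A B t|)
        (Icc 1 N) := fun x hx =>
      ((h.continuousAt_real_distAvg (hz x hx.1)).sub continuousAt_const).abs.continuousWithinAt
    obtain ⟨x, hx, hmin⟩ := isCompact_Icc.exists_isMinOn (nonempty_Icc.2 hN.le) hcont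
    refine ⟨x, ⟨by linarith [hx.1], hx.2⟩, fun y hy => ?_⟩
    by_cases hy1 : 1 ≤ y
    · exact hmin ⟨hy1, hy.2⟩
    · refine (hmin (left_mem_Icc.2 hN.le)).trans ?_
      have := h.real_distAvg_mono (not_le.1 hy1).le
      dsimp only at this ⊢
      rw [abs_of_nonpos (by linarith), abs_of_nonpos (by linarith)]
      linarith
  · intro g hg
    have hg1 := hg.2 1 ⟨by linarith, hN.le⟩
    rw [h1, abs_of_nonpos (show volume.real A - targetMeasure A B t ≤ 0 by linarith)] at hg1
    refine ⟨by linarith [(abs_le.1 hg1).1], ?_⟩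
    by_contra! hcon
    have hg' : 1 ≤ g := by
      by_contra! hlt
      have := h.real_distAvg_mono hlt.le
      dsimp only at this
      linarith
    obtain ⟨x, hx, hxv⟩ := h.exists_real_distAvg_eq hg' (v := targetMeasure A B t)
      (fun x hx => hz x hx.1) (by linarith) hcon.le
    have := hg.2 x ⟨by linarith [hx.1], hx.2.trans hg.1.2⟩
    rw [hxv, sub_self, abs_zero, abs_nonpos_iff] at this
    linarith

theorem reparam_lt {N t : ℝ} (hN : 1 < N) (ht : t < 0) :
    (∃ x, IsReparam c N A B t x) ∧ ∀ g, IsReparam c N A B t g →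
      targetMeasure A B t ≤ volume.real (distAvg c A B g) ∧
      volume.real (distAvg c A B g) ≤ volume.real B := by
  have hle := h.real_lower_le
  have hc : targetMeasure A B t ≤ volume.real B := by
    rw [targetMeasure_eq_lower]; nlinarith
  have hz : ∀ x, x ≤ 0 → volume {p | distFun c A B x p = 0} = 0 :=
    fun x hx => h.volume_level_eq_zero (by linarith)
  have h1 := h.real_distAvg_zero
  have hN0 : -N ≤ 0 := by linarith
  constructor
  · have hcont : ContinuousOn (fun x => |volume.real (distAvg c A B x) - targetMeasure A B t|)
        (Icc (-N) 0) := fun x hx =>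
      ((h.continuousAt_real_distAvg (hz x hx.2)).sub continuousAt_const).abs.continuousWithinAt
    obtain ⟨x, hx, hmin⟩ := isCompact_Icc.exists_isMinOn (nonempty_Icc.2 hN0) hcont
    refine ⟨x, ⟨hx.1, by linarith [hx.2]⟩, fun y hy => ?_⟩
    by_cases hy1 : y ≤ 0
    · exact hmin ⟨hy.1, hy1⟩
    · refine (hmin (right_mem_Icc.2 hN0)).trans ?_
      have := h.real_distAvg_mono (not_le.1 hy1).le
      dsimp only at this ⊢
      rw [abs_of_nonneg (by linarith), abs_of_nonneg (by linarith)]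
      linarith
  · intro g hg
    have hg1 := hg.2 0 ⟨hN0, by linarith⟩
    rw [h1, abs_of_nonneg (show 0 ≤ volume.real B - targetMeasure A B t by linarith)] at hg1
    refine ⟨?_, by linarith [(abs_le.1 hg1).2]⟩
    by_contra! hcon
    have hg' : g ≤ 0 := by
      by_contra! hlt
      have := h.real_distAvg_mono hlt.le
      dsimp only at this
      linarith
    obtain ⟨x, hx, hxv⟩ := h.exists_real_distAvg_eq hg' (v := targetMeasure A B t)
      (fun x hx => hz x hx.2) hcon.le (by linarith)
    have := hg.2 x ⟨hg.1.1.trans hx.1, by linarith [hx.2]⟩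
    rw [hxv, sub_self, abs_zero, abs_nonpos_iff] at this
    linarith

theorem offset_zero_inter (hB : B.Nonempty) : offset B 0 ∩ A = B := by
  ext p
  have : p ∈ B ↔ Metric.infDist p B ≤ 0 := by
    rw [h.closed.mem_iff_infDist_zero hB]
    exact ⟨fun h => h.le, fun h => le_antisymm h Metric.infDist_nonneg⟩
  exact ⟨fun hp => this.2 hp.1, fun hp => ⟨this.1 hp, h.subset hp⟩⟩

/-- The offsets of `B` sweep out the average measures. -/
theorem exists_isOffsetRadius (hB : B.Nonempty) {t : ℝ} (ht : t ∈ Icc (0 : ℝ) 1) :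
    ∃ r, IsOffsetRadius A B t r := by
  have hle := h.real_lower_le
  obtain ⟨R, hR⟩ := h.upper.bounded.subset_closedBall 0
  obtain ⟨b, hb⟩ := hB
  have hR0 : 0 ≤ R := (norm_nonneg b).trans (by simpa using hR (h.subset hb))
  have hclosed : ∀ r, IsClosed (offset B r) :=
    fun r => isClosed_le (Metric.continuous_infDist_pt B) continuous_const
  have hfin : volume.restrict A univ ≠ ⊤ := by simpa using h.upper.ne_top
  have hreal : ∀ r, volume.real (offset B r ∩ A) = ((volume.restrict A) (offset B r)).toReal :=
    fun r => by rw [measureReal_def, Measure.restrict_apply (hclosed r).measurableSet]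
  have hcont : ContinuousOn (fun r => volume.real (offset B r ∩ A)) (Icc 0 (2 * R)) := by
    intro r hr
    simp only [hreal]
    refine (ENNReal.tendsto_toReal (measure_ne_top_of_subset (subset_univ _) hfin)).comp ?_
    refine tendsto_measure_of_ae_tendsto_indicator _ (hclosed r).measurableSet
      (fun y => (hclosed y).measurableSet) MeasurableSet.univ hfin
      (Eventually.of_forall fun _ => subset_univ _) (ae_restrict_of_ae ?_)
    -- At `r = 0` the level set is `B`, possibly of positive measure. Radii approach `0` only from
    -- above, so points of `B` never leave the offset.
    have : ∀ᵐ p ∂(volume : Measure (E n)), Metric.infDist p B = r → p ∈ B := by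
      rcases hr.1.eq_or_lt with rfl | hr0
      · refine Eventually.of_forall fun p hp => ?_
        rwa [h.closed.mem_iff_infDist_zero ⟨b, hb⟩]
      · have h0 : ∀ᵐ p ∂(volume : Measure (E n)), Metric.infDist p B ≠ r := by
          rw [ae_iff]; simpa using volume_infDist_eq ⟨b, hb⟩ h.closed hr0
        filter_upwards [h0] with p hp hp' using absurd hp' hp
    filter_upwards [this] with p hp
    rcases lt_trichotomy (Metric.infDist p B) r with h1 | h1 | h1
    · filter_upwards [mem_nhdsWithin_of_mem_nhds (Ioi_mem_nhds h1)] with y hy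
      have hy : Metric.infDist p B < y := hy
      simp [offset, hy.le, h1.le]
    · have h0 := Metric.infDist_zero_of_mem (hp h1)
      filter_upwards [self_mem_nhdsWithin] with y hy
      simp [offset, h0, hy.1, hr.1]
    · filter_upwards [mem_nhdsWithin_of_mem_nhds (Iio_mem_nhds h1)] with y hy
      have hy : y < Metric.infDist p B := hy
      simp [offset, not_le.2 hy, not_le.2 h1]
  have h0 := h.offset_zero_inter ⟨b, hb⟩
  have h1 : offset B (2 * R) ∩ A = A := by
    refine inter_eq_right.2 fun p hp => ?_
    refine (Metric.infDist_le_dist_of_mem hb).trans ?_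
    have h2 : ‖p‖ ≤ R := by simpa using hR hp
    have h3 : ‖b‖ ≤ R := by simpa using hR (h.subset hb)
    rw [dist_eq_norm]
    exact (norm_sub_le p b).trans (by linarith)
  obtain ⟨r, hr, hrv⟩ := intermediate_value_Icc (by positivity) hcont
    (show targetMeasure A B t ∈ _ by
      simp only [h0, h1]
      constructor
      · rw [targetMeasure_eq_lower]; nlinarith [ht.1]
      · rw [targetMeasure_eq_upper]; nlinarith [ht.2])
  exact ⟨r, hr.1, hrv⟩

theorem isJordan_offset (hB : B.Nonempty) {r : ℝ} (hr : 0 ≤ r) : IsJordan (offset B r ∩ A) := by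
  rcases hr.eq_or_lt with rfl | hr0
  · rw [h.offset_zero_inter hB]; exact h.lower
  · refine ⟨h.upper.bounded.subset inter_subset_right,
      measure_mono_null ?_ (measure_union_null (volume_infDist_eq hB h.closed hr0) h.upper.null)⟩
    refine (frontier_inter_subset _ _).trans (union_subset_union ?_ inter_subset_right)
    exact inter_subset_left.trans
      (frontier_le_subset_eq (Metric.continuous_infDist_pt B) continuous_const)

end IsSimplePair

/-! ### Measure estimates for the simple average. -/

/-- A set between `B` and `A`, up to null sets, which splits the measure of `A \ B` in the ratio
`t : 1 - t` (at most). -/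
structure IsInner (A B : Set (E n)) (t : ℝ) (S : Set (E n)) : Prop where
  mem : S ∈ JSets n
  lower_diff : volume (B \ S) = 0
  diff_upper : volume (S \ A) = 0
  diff_lower_le : volume.real (S \ B) ≤ t * volume.real (A \ B)
  upper_diff_le : volume.real (A \ S) ≤ (1 - t) * volume.real (A \ B)

/-- A set containing `A`, up to a null set, with a bound on the excess. -/
structure IsOuter (A B : Set (E n)) (t : ℝ) (S : Set (E n)) : Prop where
  mem : S ∈ JSets n
  upper_diff : volume (A \ S) = 0
  diff_upper_le : volume.real (S \ A) ≤ (t - 1) * volume.real (A \ B)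

/-- A set contained in `B`, up to a null set, with a bound on the defect. -/
structure IsLower (A B : Set (E n)) (t : ℝ) (S : Set (E n)) : Prop where
  mem : S ∈ JSets n
  diff_lower : volume (S \ B) = 0
  lower_diff_le : volume.real (B \ S) ≤ -t * volume.real (A \ B)

theorem volume_diff_ci {S D : Set (E n)} (hD : IsJordan D) :
    volume (S \ ci D) = volume (S \ D) :=
  measure_congr ((ae_eq_refl S).diff hD.ci_ae_eq)

theorem volume_ci_diff {S D : Set (E n)} (hD : IsJordan D) :
    volume (ci D \ S) = volume (D \ S) :=
  measure_congr (hD.ci_ae_eq.diff (ae_eq_refl S))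

theorem real_ci {D : Set (E n)} (hD : IsJordan D) : volume.real (ci D) = volume.real D :=
  measureReal_congr hD.ci_ae_eq

namespace IsSimplePair

variable {c : Set (E n) → E n} {A B : Set (E n)} (h : IsSimplePair c A B)
include h

theorem isInner_ci {D : Set (E n)} {t : ℝ} (hD : IsJordan D) (h1 : volume (B \ D) = 0)
    (h2 : volume (D \ A) = 0) (h3 : volume.real D = targetMeasure A B t) :
    IsInner A B t (ci D) := by
  have hJ := IsJordan.of_mem hD.ci_mem
  rw [← volume_diff_ci hD] at h1
  rw [← volume_ci_diff hD] at h2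
  rw [← real_ci hD] at h3
  refine ⟨hD.ci_mem, h1, h2, ?_, ?_⟩
  · rw [h.lower.real_diff hJ h1, h3, h.real_diff_eq, targetMeasure_eq_lower]
    apply le_of_eq; ring
  · rw [hJ.real_diff h.upper h2, h3, h.real_diff_eq, targetMeasure_eq_upper]
    apply le_of_eq; ring

theorem isOuter_ci {D : Set (E n)} {t : ℝ} (hD : IsJordan D) (h1 : volume (A \ D) = 0)
    (h3 : volume.real D ≤ targetMeasure A B t) : IsOuter A B t (ci D) := by
  have hJ := IsJordan.of_mem hD.ci_mem
  rw [← volume_diff_ci hD] at h1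
  rw [← real_ci hD] at h3
  refine ⟨hD.ci_mem, h1, ?_⟩
  rw [h.upper.real_diff hJ h1, h.real_diff_eq]
  rw [targetMeasure_eq_upper] at h3
  linarith

theorem isLower_ci {D : Set (E n)} {t : ℝ} (hD : IsJordan D) (h1 : volume (D \ B) = 0)
    (h3 : targetMeasure A B t ≤ volume.real D) : IsLower A B t (ci D) := by
  have hJ := IsJordan.of_mem hD.ci_mem
  rw [← volume_ci_diff hD] at h1
  rw [← real_ci hD] at h3
  refine ⟨hD.ci_mem, h1, ?_⟩
  rw [hJ.real_diff h.lower h1, h.real_diff_eq]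
  rw [targetMeasure_eq_lower] at h3
  linarith

end IsSimplePair

section simpleAvg

variable {P : AverageChoices n} {A B : Set (E n)} {t : ℝ}

theorem simpleAvg_isInner (h : IsSimplePair P.center A B) (ht : t ∈ Icc (0 : ℝ) 1) :
    IsInner A B t (simpleAvg P A B t) := by
  have hle := h.real_lower_le
  have hB : volume.real B ≤ targetMeasure A B t := by
    rw [IsSimplePair.targetMeasure_eq_lower]; nlinarith [ht.1]
  have hA : targetMeasure A B t ≤ volume.real A := by
    rw [IsSimplePair.targetMeasure_eq_upper]; nlinarith [ht.2]
  unfold simpleAvg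
  split_ifs with hc
  · have hz : ZeroMeasureCond P.center A B := hc.resolve_right (not_not.2 ht)
    obtain ⟨hex, hall⟩ := h.reparam_inner P.one_lt_N hz ht
    have hg := hall _ (P.g_spec A B t hex)
    have hD : IsJordan (distAvg P.center A B (P.g A B t)) := h.isJordan_distAvg <| by
      by_cases hx : P.g A B t = 1 / 2
      · rw [hx]; exact hz
      · exact h.volume_level_eq_zero hx
    exact h.isInner_ci hD (h.volume_diff_distAvg h.distAvg_zero_ae_eq (hB.trans hg.ge))
      (h.volume_distAvg_diff h.distAvg_one_ae_eq (hg.le.trans hA)) hg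
  · have hBne : B.Nonempty := by
      by_contra hne
      exact hc (Or.inl (h.zeroMeasureCond_of_empty (not_nonempty_iff_eq_empty.1 hne)))
    obtain ⟨hr0, hr⟩ := P.r_spec A B t (h.exists_isOffsetRadius hBne ht)
    refine h.isInner_ci (h.isJordan_offset hBne hr0) ?_ ?_ hr
    · rw [sdiff_eq_empty.2, measure_empty]
      exact fun p hp => ⟨(Metric.infDist_zero_of_mem hp).trans_le hr0, h.subset hp⟩
    · rw [sdiff_eq_empty.2 inter_subset_right, measure_empty]

theorem simpleAvg_isOuter (h : IsSimplePair P.center A B) (ht : 1 < t) :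
    IsOuter A B t (simpleAvg P A B t) := by
  unfold simpleAvg
  rw [if_pos (Or.inr fun h' => absurd h'.2 (not_le.2 ht))]
  obtain ⟨hex, hall⟩ := h.reparam_gt P.one_lt_N ht
  obtain ⟨h1, h2⟩ := hall _ (P.g_spec A B t hex)
  have h3 := h.volume_diff_distAvg h.distAvg_one_ae_eq h1
  refine h.isOuter_ci ?_ h3 h2
  -- A minimizer may equal `1/2` when that average already fills `A` up to a null set. Its level set
  -- need not be null, so the Jordan property comes from lying between `A` and `closure A` up to a
  -- null set.
  by_cases hx : P.g A B t = 1 / 2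
  · refine h.upper.of_isClosed ?_ (h.isClosed_distAvg _) h3
    rw [← h.distAvg_one, hx]
    exact h.distAvg_mono (by norm_num)
  · exact h.isJordan_distAvg (h.volume_level_eq_zero hx)

theorem simpleAvg_isLower (h : IsSimplePair P.center A B) (ht : t < 0) :
    IsLower A B t (simpleAvg P A B t) := by
  unfold simpleAvg
  rw [if_pos (Or.inr fun h' => absurd h'.1 (not_le.2 ht))]
  obtain ⟨hex, hall⟩ := h.reparam_lt P.one_lt_N ht
  obtain ⟨h1, h2⟩ := hall _ (P.g_spec A B t hex)
  have h3 := h.volume_distAvg_diff h.distAvg_zero_ae_eq h2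
  refine h.isLower_ci ?_ h3 h1
  -- Here the average at `1/2` contains the one at `0`, exceeding it only by a null set.
  by_cases hx : P.g A B t = 1 / 2
  · refine IsJordan.of_subset_closed (A := distAvg P.center A B 0) (h.isBounded_distAvg _)
      (h.isJordan_distAvg (h.volume_level_eq_zero (by norm_num)))
      (h.distAvg_mono (by rw [hx]; norm_num)) (h.isClosed_distAvg _) ?_
    rwa [measure_congr ((ae_eq_refl _).diff h.distAvg_zero_ae_eq)]
  · exact h.isJordan_distAvg (h.volume_level_eq_zero hx)

end simpleAvg

/-! ### Components and pieces of a difference. -/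

/-- A union of connected components of `D`. -/
def IsSaturated (D C : Set (E n)) : Prop :=
  C ⊆ D ∧ ∀ x ∈ C, connectedComponentIn D x ⊆ C

theorem isSaturated_of_mem_components {D C : Set (E n)} (hC : C ∈ components D) :
    IsSaturated D C := by
  obtain ⟨x, -, rfl⟩ := hC
  exact ⟨connectedComponentIn_subset _ _, fun y hy => (connectedComponentIn_eq hy).symm.subset⟩

theorem nonempty_of_mem_components {D C : Set (E n)} (hC : C ∈ components D) : C.Nonempty := by
  obtain ⟨x, hx, rfl⟩ := hC
  exact ⟨x, mem_connectedComponentIn hx⟩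

theorem isSaturated_sUnion {D : Set (E n)} {S : Set (Set (E n))} (hS : S ⊆ components D) :
    IsSaturated D (⋃₀ S) :=
  ⟨sUnion_subset fun _ hC => (isSaturated_of_mem_components (hS hC)).1, by
    rintro x ⟨C, hC, hx⟩
    exact ((isSaturated_of_mem_components (hS hC)).2 x hx).trans (subset_sUnion_of_mem hC)⟩

theorem sUnion_components (D : Set (E n)) : ⋃₀ components D = D := by
  refine subset_antisymm (isSaturated_sUnion subset_rfl).1 fun x hx => ?_
  exact ⟨_, ⟨x, hx, rfl⟩, mem_connectedComponentIn hx⟩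

theorem eq_of_mem_components {D C₁ C₂ : Set (E n)} (h₁ : C₁ ∈ components D)
    (h₂ : C₂ ∈ components D) {x : E n} (hx₁ : x ∈ C₁) (hx₂ : x ∈ C₂) : C₁ = C₂ := by
  obtain ⟨y, -, rfl⟩ := h₁
  obtain ⟨z, -, rfl⟩ := h₂
  rw [connectedComponentIn_eq hx₁, connectedComponentIn_eq hx₂]

/-- Around a limit point of `C` in `interior A \ closure B` there is a ball contained in `A \ B`. It
is connected and meets `C`, so it lies in `C`, and the point is interior. -/
theorem frontier_union_subset_of_isSaturated {A B C : Set (E n)} (hC : IsSaturated (A \ B) C)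
    (hBA : B ⊆ A) : frontier (B ∪ C) ⊆ frontier A ∪ frontier B := by
  intro p hp
  by_contra hcon
  rw [mem_union, not_or] at hcon
  have hpA : p ∈ closure A :=
    closure_mono (union_subset hBA (hC.1.trans sdiff_subset)) hp.1
  have hpA' : p ∈ interior A := by
    by_contra h; exact hcon.1 ⟨hpA, h⟩
  have hpB : p ∉ interior B := fun h => hp.2 (interior_mono subset_union_left h)
  have hpB' : p ∉ closure B := fun h => hcon.2 ⟨h, hpB⟩
  have hopen : IsOpen (interior A \ closure B) := isOpen_interior.sdiff isClosed_closure
  obtain ⟨r, hr, hball⟩ := Metric.isOpen_iff.1 hopen p ⟨hpA', hpB'⟩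
  obtain ⟨z, hz, hzBC⟩ := mem_closure_iff.1 hp.1 _ Metric.isOpen_ball (Metric.mem_ball_self hr)
  have hzC : z ∈ C := hzBC.resolve_left fun h => (hball hz).2 (subset_closure h)
  have hsub : Metric.ball p r ⊆ connectedComponentIn (A \ B) z :=
    (convex_ball p r).isPreconnected.subset_connectedComponentIn hz fun y hy =>
      ⟨interior_subset (hball hy).1, fun h => (hball hy).2 (subset_closure h)⟩
  refine hp.2 (mem_interior.2 ⟨Metric.ball p r, ?_, Metric.isOpen_ball, Metric.mem_ball_self hr⟩)
  exact (hsub.trans (hC.2 z hzC)).trans subset_union_right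

theorem isJordan_union_of_isSaturated {A B C : Set (E n)} (hA : IsJordan A) (hB : IsJordan B)
    (hC : IsSaturated (A \ B) C) (hBA : B ⊆ A) : IsJordan (B ∪ C) :=
  ⟨hA.bounded.subset (union_subset hBA (hC.1.trans sdiff_subset)),
    measure_mono_null (frontier_union_subset_of_isSaturated hC hBA)
      (measure_union_null hA.null hB.null)⟩

theorem union_sdiff_of_isSaturated {A B C : Set (E n)} (hC : IsSaturated (A \ B) C) :
    (B ∪ C) \ B = C := by
  rw [union_sdiff_left, sdiff_eq_left]
  exact disjoint_left.2 fun x hx => (hC.1 hx).2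

theorem isJordan_of_isSaturated {A B C : Set (E n)} (hA : IsJordan A) (hB : IsJordan B)
    (hC : IsSaturated (A \ B) C) (hBA : B ⊆ A) : IsJordan C := by
  rw [← union_sdiff_of_isSaturated hC]
  exact (isJordan_union_of_isSaturated hA hB hC hBA).diff hB

/-- Components are disjoint and `A \ B` has finite measure. -/
theorem finite_large_components {A B : Set (E n)} (hA : IsJordan A) (hB : IsJordan B)
    (hBA : B ⊆ A) {ε : ℝ} (hε : 0 < ε) :
    {C ∈ components (A \ B) | ε ≤ volume.real C}.Finite := by
  have hJ := fun C : components (A \ B) =>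
    isJordan_of_isSaturated hA hB (isSaturated_of_mem_components C.2) hBA
  have hfin := Measure.finite_const_le_meas_of_disjoint_iUnion₀ volume
    (ENNReal.ofReal_pos.2 hε) (As := fun C : components (A \ B) => (C : Set (E n)))
    (fun C => (hJ C).nullMeasurableSet)
    (fun C₁ C₂ hne => (disjoint_left.2 fun x h₁ h₂ =>
      hne (Subtype.ext (eq_of_mem_components C₁.2 C₂.2 h₁ h₂))).aedisjoint)
    (by rw [← sUnion_eq_iUnion, sUnion_components]; exact (hA.diff hB).ne_top)
  refine (hfin.image Subtype.val).subset ?_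
  rintro C ⟨hC, hCε⟩
  exact ⟨⟨C, hC⟩, ENNReal.ofReal_le_of_le_toReal hCε, rfl⟩

section pieces

variable {P : AverageChoices n} {A B : Set (E n)}

theorem finite_pieces (hA : IsJordan A) (hB : IsJordan B) (hBA : B ⊆ A) :
    (pieces P A B).Finite := by
  unfold pieces
  split_ifs with h
  · exact h
  · exact (finite_large_components hA hB hBA P.ε_pos).insert _

theorem isSaturated_of_mem_pieces {C : Set (E n)} (hC : C ∈ pieces P A B) :
    IsSaturated (A \ B) C := by
  unfold pieces at hC
  split_ifs at hC with h
  · exact isSaturated_of_mem_components hC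
  · rcases hC with rfl | hC
    · exact isSaturated_sUnion fun _ h => h.1
    · exact isSaturated_of_mem_components hC.1

/-- An empty union of small components would make all components large, hence finitely many,
contrary to the case in which that union is formed. -/
theorem nonempty_of_mem_pieces (hA : IsJordan A) (hB : IsJordan B) (hBA : B ⊆ A)
    {C : Set (E n)} (hC : C ∈ pieces P A B) : C.Nonempty := by
  unfold pieces at hC
  split_ifs at hC with h
  · exact nonempty_of_mem_components hC
  · rcases hC with rfl | hC
    · by_contra hne
      refine h ((finite_large_components hA hB hBA P.ε_pos).subset fun C hC => ⟨hC, ?_⟩)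
      by_contra hlt
      obtain ⟨x, hx⟩ := nonempty_of_mem_components hC
      exact hne ⟨x, C, ⟨hC, not_le.1 hlt⟩, hx⟩
    · exact nonempty_of_mem_components hC.1

theorem sUnion_pieces : ⋃₀ pieces P A B = A \ B := by
  unfold pieces
  split_ifs with h
  · exact sUnion_components _
  · rw [sUnion_insert, ← sUnion_union]
    conv_rhs => rw [← sUnion_components (A \ B)]
    congr 1
    ext C
    simp only [mem_union, mem_ofPred_eq, ← and_or_left, lt_or_ge, and_true]

theorem pairwiseDisjoint_pieces : (pieces P A B).PairwiseDisjoint id := by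
  have hsmall : ∀ C ∈ components (A \ B), P.ε ≤ volume.real C →
      Disjoint (⋃₀ {C ∈ components (A \ B) | volume.real C < P.ε}) C := by
    intro C hC hCε
    refine disjoint_left.2 ?_
    rintro x ⟨C', hC', hx'⟩ hx
    rw [eq_of_mem_components hC'.1 hC hx' hx] at hC'
    exact absurd hC'.2 (not_lt.2 hCε)
  intro C₁ h₁ C₂ h₂ hne
  unfold pieces at h₁ h₂
  have hcomp : C₁ ∈ components (A \ B) → C₂ ∈ components (A \ B) → Disjoint C₁ C₂ :=
    fun h₁ h₂ => disjoint_left.2 fun x hx₁ hx₂ => hne (eq_of_mem_components h₁ h₂ hx₁ hx₂)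
  split_ifs at h₁ h₂ with h
  · exact hcomp h₁ h₂
  · rcases h₁ with h₁ | h₁ <;> rcases h₂ with h₂ | h₂
    · exact absurd (h₁.trans h₂.symm) hne
    · rw [h₁]; exact hsmall C₂ h₂.1 h₂.2
    · rw [h₂]; exact (hsmall C₁ h₁.1 h₁.2).symm
    · exact hcomp h₁.1 h₂.1

theorem pieces_nonempty (hBA : B ⊆ A) (hne : A ≠ B) : (pieces P A B).Nonempty := by
  by_contra h
  have h1 := sUnion_pieces (P := P) (A := A) (B := B)
  rw [not_nonempty_iff_eq_empty.1 h, sUnion_empty] at h1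
  exact hne (subset_antisymm (sdiff_eq_empty.1 h1.symm) hBA)

theorem isSimplePair_of_mem_pieces (hn : 0 < n) (hA : IsJordan A) (hB : IsJordan B)
    (hBc : IsClosed B) (hBA : B ⊆ A) {C : Set (E n)} (hC : C ∈ pieces P A B) :
    IsSimplePair P.center (B ∪ C) B := by
  have hJ := isJordan_union_of_isSaturated hA hB (isSaturated_of_mem_pieces hC) hBA
  have hne : (B ∪ C).Nonempty := (nonempty_of_mem_pieces hA hB hBA hC).mono subset_union_right
  exact ⟨hn, hne, hJ, hB, hBc, subset_union_left, P.center_spec _ hne hJ.bounded⟩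

/-- A union bound over the pieces. -/
theorem real_le_of_subset_biUnion_pieces (hA : IsJordan A) (hB : IsJordan B) (hBA : B ⊆ A)
    {X : Set (E n)} {f : Set (E n) → Set (E n)} {a : ℝ}
    (hX : X ⊆ ⋃ C ∈ pieces P A B, f C)
    (hfin : ∀ C ∈ pieces P A B, volume (f C) ≠ ⊤)
    (hf : ∀ C ∈ pieces P A B, volume.real (f C) ≤ a * volume.real ((B ∪ C) \ B)) :
    volume.real X ≤ a * volume.real (A \ B) := by
  have hs := finite_pieces (P := P) hA hB hBA
  have hsum : ∑ C ∈ hs.toFinset, volume.real C = volume.real (A \ B) := by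
    rw [← sUnion_pieces (P := P), sUnion_eq_biUnion]
    have := measureReal_biUnion_finset₀ (μ := volume) (s := hs.toFinset) (f := id)
      (by
        rw [hs.coe_toFinset]
        exact fun C₁ h₁ C₂ h₂ hne => (pairwiseDisjoint_pieces h₁ h₂ hne).aedisjoint)
      (fun C hC => (isJordan_of_isSaturated hA hB
        (isSaturated_of_mem_pieces (hs.mem_toFinset.1 hC)) hBA).nullMeasurableSet)
      (fun C hC => (isJordan_of_isSaturated hA hB
        (isSaturated_of_mem_pieces (hs.mem_toFinset.1 hC)) hBA).ne_top)
    simpa using this.symm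
  have hX' : X ⊆ ⋃ C ∈ hs.toFinset, f C := by simpa using hX
  have htop : volume (⋃ C ∈ hs.toFinset, f C) ≠ ⊤ :=
    (measure_biUnion_lt_top hs.toFinset.finite_toSet fun C hC =>
      (hfin C (hs.mem_toFinset.1 hC)).lt_top).ne
  calc volume.real X ≤ volume.real (⋃ C ∈ hs.toFinset, f C) := measureReal_mono hX' htop
    _ ≤ ∑ C ∈ hs.toFinset, volume.real (f C) := measureReal_biUnion_finset_le _ _
    _ ≤ ∑ C ∈ hs.toFinset, a * volume.real C := by
        refine Finset.sum_le_sum fun C hC => ?_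
        have hC := hs.mem_toFinset.1 hC
        have := hf C hC
        rwa [union_sdiff_of_isSaturated (isSaturated_of_mem_pieces hC)] at this
    _ = a * volume.real (A \ B) := by rw [← Finset.mul_sum, hsum]

theorem volume_eq_zero_of_subset_biUnion_pieces (hA : IsJordan A) (hB : IsJordan B)
    (hBA : B ⊆ A) {X : Set (E n)} {f : Set (E n) → Set (E n)}
    (hX : X ⊆ ⋃ C ∈ pieces P A B, f C) (hf : ∀ C ∈ pieces P A B, volume (f C) = 0) :
    volume X = 0 :=
  measure_mono_null hX ((measure_biUnion_null_iff (finite_pieces hA hB hBA).countable).2 hf)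

theorem union_subset_of_mem_pieces (hBA : B ⊆ A) {C : Set (E n)} (hC : C ∈ pieces P A B) :
    B ∪ C ⊆ A :=
  union_subset hBA ((isSaturated_of_mem_pieces hC).1.trans sdiff_subset)

/-- The set `A` is the union of the sets `B ∪ C`, where `C` is a piece. -/
theorem subset_biUnion_union_pieces (hBA : B ⊆ A) (hne : A ≠ B) :
    A ⊆ ⋃ C ∈ pieces P A B, (B ∪ C) := by
  intro p hp
  by_cases hpB : p ∈ B
  · obtain ⟨C, hC⟩ := pieces_nonempty (P := P) hBA hne
    exact mem_biUnion hC (Or.inl hpB)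
  · have : p ∈ ⋃₀ pieces P A B := by rw [sUnion_pieces]; exact ⟨hp, hpB⟩
    obtain ⟨C, hC, hpC⟩ := this
    exact mem_biUnion hC (Or.inr hpC)

end pieces

/-! ### Averages of nested sets. -/

section nestedAvg

variable {P : AverageChoices n} {A B : Set (E n)} {t : ℝ}

/-- Covering `B` needs a single piece. The excess over `B` and the defect in `A` are bounded piece
by piece and summed by disjointness; this is why `IsInner` records inequalities. -/
theorem nestedAvg_isInner (hn : 0 < n) (hA : A ∈ JSets n) (hB : B ∈ JSets n) (hBA : B ⊆ A)
    (ht : t ∈ Icc (0 : ℝ) 1) : IsInner A B t (nestedAvg P A B t) := by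
  unfold nestedAvg
  split_ifs with he h0
  · subst he
    exact ⟨hA, by simp, by simp, by simp, by simp⟩
  · have hAJ := IsJordan.of_mem hA
    have hBJ := IsJordan.of_mem hB
    have hS : ∀ C ∈ pieces P A B, IsInner (B ∪ C) B t (simpleAvg P (B ∪ C) B t) := fun C hC =>
      simpleAvg_isInner (isSimplePair_of_mem_pieces hn hAJ hBJ (isClosed_of_mem_JSets hB) hBA hC) ht
    have hSJ := fun C hC => IsJordan.of_mem (hS C hC).mem
    have hUJ : ∀ C ∈ pieces P A B, IsJordan (B ∪ C) := fun C hC =>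
      isJordan_union_of_isSaturated hAJ hBJ (isSaturated_of_mem_pieces hC) hBA
    refine ⟨biUnion_mem_JSets (finite_pieces hAJ hBJ hBA) fun C hC => (hS C hC).mem, ?_, ?_, ?_, ?_⟩
    · obtain ⟨C, hC⟩ := pieces_nonempty (P := P) hBA he
      refine measure_mono_null ?_ (hS C hC).lower_diff
      exact sdiff_subset_sdiff_right
        (subset_biUnion_of_mem (u := fun C => simpleAvg P (B ∪ C) B t) hC)
    · refine volume_eq_zero_of_subset_biUnion_pieces hAJ hBJ hBA (P := P)
        (f := fun C => simpleAvg P (B ∪ C) B t \ (B ∪ C)) ?_ fun C hC => (hS C hC).diff_upper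
      rintro p ⟨hp, hpA⟩
      obtain ⟨C, hC, hpC⟩ := mem_iUnion₂.1 hp
      exact mem_biUnion hC ⟨hpC, fun h => hpA (union_subset_of_mem_pieces hBA hC h)⟩
    · refine real_le_of_subset_biUnion_pieces hAJ hBJ hBA (P := P)
        (f := fun C => simpleAvg P (B ∪ C) B t \ B) ?_
        (fun C hC => ((hSJ C hC).diff hBJ).ne_top) fun C hC => (hS C hC).diff_lower_le
      rintro p ⟨hp, hpB⟩
      obtain ⟨C, hC, hpC⟩ := mem_iUnion₂.1 hp
      exact mem_biUnion hC ⟨hpC, hpB⟩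
    · refine real_le_of_subset_biUnion_pieces hAJ hBJ hBA (P := P)
        (f := fun C => (B ∪ C) \ simpleAvg P (B ∪ C) B t) ?_
        (fun C hC => ((hUJ C hC).diff (hSJ C hC)).ne_top) fun C hC => (hS C hC).upper_diff_le
      rintro p ⟨hp, hpN⟩
      obtain ⟨C, hC, hpC⟩ := mem_iUnion₂.1 (subset_biUnion_union_pieces (P := P) hBA he hp)
      exact mem_biUnion hC ⟨hpC, fun h => hpN (mem_biUnion hC h)⟩
  · exact absurd ht.1 h0

theorem nestedAvg_isOuter (hn : 0 < n) (hA : A ∈ JSets n) (hB : B ∈ JSets n) (hBA : B ⊆ A)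
    (ht : 1 < t) : IsOuter A B t (nestedAvg P A B t) := by
  unfold nestedAvg
  split_ifs with he h0
  · subst he
    exact ⟨hA, by simp, by simp⟩
  · have hAJ := IsJordan.of_mem hA
    have hBJ := IsJordan.of_mem hB
    have hS : ∀ C ∈ pieces P A B, IsOuter (B ∪ C) B t (simpleAvg P (B ∪ C) B t) := fun C hC =>
      simpleAvg_isOuter (isSimplePair_of_mem_pieces hn hAJ hBJ (isClosed_of_mem_JSets hB) hBA hC) ht
    have hSJ := fun C hC => IsJordan.of_mem (hS C hC).mem
    have hUJ : ∀ C ∈ pieces P A B, IsJordan (B ∪ C) := fun C hC =>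
      isJordan_union_of_isSaturated hAJ hBJ (isSaturated_of_mem_pieces hC) hBA
    refine ⟨biUnion_mem_JSets (finite_pieces hAJ hBJ hBA) fun C hC => (hS C hC).mem, ?_, ?_⟩
    · refine volume_eq_zero_of_subset_biUnion_pieces hAJ hBJ hBA (P := P)
        (f := fun C => (B ∪ C) \ simpleAvg P (B ∪ C) B t) ?_ fun C hC => (hS C hC).upper_diff
      rintro p ⟨hp, hpN⟩
      obtain ⟨C, hC, hpC⟩ := mem_iUnion₂.1 (subset_biUnion_union_pieces (P := P) hBA he hp)
      exact mem_biUnion hC ⟨hpC, fun h => hpN (mem_biUnion hC h)⟩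
    · refine real_le_of_subset_biUnion_pieces hAJ hBJ hBA (P := P)
        (f := fun C => simpleAvg P (B ∪ C) B t \ (B ∪ C)) ?_
        (fun C hC => ((hSJ C hC).diff (hUJ C hC)).ne_top) fun C hC => (hS C hC).diff_upper_le
      rintro p ⟨hp, hpA⟩
      obtain ⟨C, hC, hpC⟩ := mem_iUnion₂.1 hp
      exact mem_biUnion hC ⟨hpC, fun h => hpA (union_subset_of_mem_pieces hBA hC h)⟩
  · exact absurd (zero_le_one.trans ht.le) h0

/-- Removing an intersection from `B` leaves the union of the individual defects, which again sum to
`-t` times the measure of `A \ B`. -/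
theorem nestedAvg_isLower (hn : 0 < n) (hA : A ∈ JSets n) (hB : B ∈ JSets n) (hBA : B ⊆ A)
    (ht : t < 0) : IsLower A B t (nestedAvg P A B t) := by
  unfold nestedAvg
  split_ifs with he h0
  · subst he
    exact ⟨hA, by simp, by simp⟩
  · exact absurd ht (not_lt.2 h0)
  · have hAJ := IsJordan.of_mem hA
    have hBJ := IsJordan.of_mem hB
    have hS : ∀ C ∈ pieces P A B, IsLower (B ∪ C) B t (simpleAvg P (B ∪ C) B t) := fun C hC =>
      simpleAvg_isLower (isSimplePair_of_mem_pieces hn hAJ hBJ (isClosed_of_mem_JSets hB) hBA hC) ht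
    have hSJ := fun C hC => IsJordan.of_mem (hS C hC).mem
    have hJ := IsJordan.biInter (finite_pieces hAJ hBJ hBA) (pieces_nonempty (P := P) hBA he) hSJ
    refine ⟨hJ.ci_mem, ?_, ?_⟩
    · rw [volume_ci_diff hJ]
      obtain ⟨C, hC⟩ := pieces_nonempty (P := P) hBA he
      refine measure_mono_null ?_ (hS C hC).diff_lower
      exact sdiff_subset_sdiff_left (biInter_subset_of_mem hC)
    · rw [measureReal_def, volume_diff_ci hJ, ← measureReal_def]
      refine real_le_of_subset_biUnion_pieces hAJ hBJ hBA (P := P)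
        (f := fun C => B \ simpleAvg P (B ∪ C) B t) ?_
        (fun C hC => (hBJ.diff (hSJ C hC)).ne_top) fun C hC => (hS C hC).lower_diff_le
      rintro p ⟨hp, hpN⟩
      simp only [mem_iInter, not_forall] at hpN
      obtain ⟨C, hC, hpC⟩ := hpN
      exact mem_biUnion hC ⟨hp, hpC⟩

end nestedAvg

/-! ### The metric `dMu` and averages of general sets. -/

theorem dMu_comm (A B : Set (E n)) : dMu A B = dMu B A := by
  unfold dMu; rw [symmDiff_comm]

theorem dMu_nonneg (A B : Set (E n)) : 0 ≤ dMu A B := measureReal_nonneg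

theorem dMu_triangle {A B C : Set (E n)} (hA : volume A ≠ ⊤) (hB : volume B ≠ ⊤) :
    dMu A C ≤ dMu A B + dMu B C := measureReal_symmDiff_le C hA hB

theorem dMu_le_add (A B : Set (E n)) :
    dMu A B ≤ volume.real (A \ B) + volume.real (B \ A) := measureReal_union_le _ _

theorem dMu_eq_add {A B : Set (E n)} (hA : IsJordan A) (hB : IsJordan B) :
    dMu A B = volume.real (A \ B) + volume.real (B \ A) := by
  unfold dMu
  rw [measureReal_def, measure_symmDiff_eq hA.nullMeasurableSet hB.nullMeasurableSet,
    ENNReal.toReal_add (hA.diff hB).ne_top (hB.diff hA).ne_top]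
  rfl

theorem real_le_of_subset_union_null {X Y Z : Set (E n)} (h : X ⊆ Y ∪ Z) (hY : volume Y ≠ ⊤)
    (hZ : volume Z = 0) : volume.real X ≤ volume.real Y :=
  ENNReal.toReal_mono hY ((measure_mono h).trans ((measure_union_le _ _).trans_eq (by simp [hZ])))

section measureAvg

variable {P : AverageChoices n} {A B : Set (E n)} {t : ℝ}

theorem ci_inter_subset (hA : A ∈ JSets n) (hB : B ∈ JSets n) : ci (A ∩ B) ⊆ A ∩ B :=
  closure_minimal interior_subset ((isClosed_of_mem_JSets hA).inter (isClosed_of_mem_JSets hB))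

theorem real_diff_ci_inter (hA : A ∈ JSets n) (hB : B ∈ JSets n) :
    volume.real (A \ ci (A ∩ B)) = volume.real (A \ B) := by
  rw [measureReal_def, volume_diff_ci ((IsJordan.of_mem hA).inter (IsJordan.of_mem hB)),
    sdiff_self_inter]
  rfl

/-- Outside `A` the average has only points of `R₂ \ I`, up to null sets, and inside `A` it misses
at most `A \ R₁`. These have measure at most `1 - t` times that of `B \ A` and of `A \ B`. The
estimate for `B` is symmetric. -/
theorem convexAvg_spec (hn : 0 < n) (hA : A ∈ JSets n) (hB : B ∈ JSets n)
    (ht : t ∈ Icc (0 : ℝ) 1) :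
    measureAvg P A B t ∈ JSets n ∧ dMu (measureAvg P A B t) A ≤ (1 - t) * dMu A B ∧
      dMu (measureAvg P A B t) B ≤ t * dMu A B := by
  have hAJ := IsJordan.of_mem hA
  have hBJ := IsJordan.of_mem hB
  have hI := (hAJ.inter hBJ).ci_mem
  have hIA : ci (A ∩ B) ⊆ A := (ci_inter_subset hA hB).trans inter_subset_left
  have hIB : ci (A ∩ B) ⊆ B := (ci_inter_subset hA hB).trans inter_subset_right
  have h1 := nestedAvg_isInner (P := P) hn hA hI hIA ht
  have h2 := nestedAvg_isInner (P := P) hn hB hI hIB (t := 1 - t)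
    ⟨by linarith [ht.2], by linarith [ht.1]⟩
  have hrA := real_diff_ci_inter hA hB
  have hrB := real_diff_ci_inter hB hA
  rw [inter_comm] at hrB
  unfold measureAvg
  rw [if_neg (not_lt.2 ht.1), if_pos ht.2, dMu_eq_add hAJ hBJ]
  set I := ci (A ∩ B)
  set R₁ := nestedAvg P A I t
  set R₂ := nestedAvg P B I (1 - t)
  have hIJ := IsJordan.of_mem hI
  have h1J := IsJordan.of_mem h1.mem
  have h2J := IsJordan.of_mem h2.mem
  have h3 := h1.diff_lower_le
  have h4 := h1.upper_diff_le
  have h5 := h2.diff_lower_le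
  have h6 := h2.upper_diff_le
  rw [hrA] at h3 h4
  rw [hrB] at h5 h6
  refine ⟨union_mem_JSets h1.mem h2.mem, (dMu_le_add _ _).trans ?_, (dMu_le_add _ _).trans ?_⟩
  · have h7 : volume.real ((R₁ ∪ R₂) \ A) ≤ volume.real (R₂ \ I) := by
      refine real_le_of_subset_union_null ?_ (h2J.diff hIJ).ne_top h1.diff_upper
      rintro p ⟨hp | hp, hpA⟩
      · exact Or.inr ⟨hp, hpA⟩
      · exact Or.inl ⟨hp, fun h => hpA (hIA h)⟩
    have h8 : volume.real (A \ (R₁ ∪ R₂)) ≤ volume.real (A \ R₁) :=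
      measureReal_mono (sdiff_subset_sdiff_right subset_union_left) (hAJ.diff h1J).ne_top
    linarith
  · have h7 : volume.real ((R₁ ∪ R₂) \ B) ≤ volume.real (R₁ \ I) := by
      refine real_le_of_subset_union_null ?_ (h1J.diff hIJ).ne_top h2.diff_upper
      rintro p ⟨hp | hp, hpB⟩
      · exact Or.inl ⟨hp, fun h => hpB (hIB h)⟩
      · exact Or.inr ⟨hp, hpB⟩
    have h8 : volume.real (B \ (R₁ ∪ R₂)) ≤ volume.real (B \ R₂) :=
      measureReal_mono (sdiff_subset_sdiff_right subset_union_right) (hBJ.diff h2J).ne_top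
    linarith

/-- The excess over `A` comes from `R₁` and is at most `t - 1` times the measure of `A \ B`. What is
lost from `A` is, up to null sets, `I \ R₂`, at most `t - 1` times the measure of `B \ A`. -/
theorem extrapAvg_spec (hn : 0 < n) (hA : A ∈ JSets n) (hB : B ∈ JSets n) (ht : 1 < t) :
    extrapAvg P A B t ∈ JSets n ∧ dMu (extrapAvg P A B t) A ≤ (t - 1) * dMu A B := by
  have hAJ := IsJordan.of_mem hA
  have hBJ := IsJordan.of_mem hB
  have hIJ' := hAJ.inter hBJ
  have hI := hIJ'.ci_mem
  have hIA : ci (A ∩ B) ⊆ A := (ci_inter_subset hA hB).trans inter_subset_left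
  have hIB : ci (A ∩ B) ⊆ B := (ci_inter_subset hA hB).trans inter_subset_right
  have h1 := nestedAvg_isOuter (P := P) hn hA hI hIA ht
  have h2 := nestedAvg_isLower (P := P) hn hB hI hIB (t := 1 - t) (by linarith)
  have hrA := real_diff_ci_inter hA hB
  have hrB := real_diff_ci_inter hB hA
  rw [inter_comm] at hrB
  have hnull : volume ((A ∩ B) \ ci (A ∩ B)) = 0 := by
    rw [volume_diff_ci hIJ']; simp
  unfold extrapAvg
  rw [dMu_eq_add hAJ hBJ]
  set I := ci (A ∩ B)
  set R₁ := nestedAvg P A I t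
  set R₂ := nestedAvg P B I (1 - t)
  have hIJ := IsJordan.of_mem hI
  have h1J := IsJordan.of_mem h1.mem
  have h2J := IsJordan.of_mem h2.mem
  have hQ : IsJordan (R₁ \ (A ∩ B)) := h1J.diff hIJ'
  have hQnull : volume ((R₁ \ (A ∩ B)) \ ci (R₁ \ (A ∩ B))) = 0 := by
    rw [volume_diff_ci hQ]; simp
  have hQA := volume_ci_diff (S := A) hQ
  have hQJ := hQ.ci_mem
  set Q := ci (R₁ \ (A ∩ B))
  have h3 := h1.diff_upper_le
  have h5 := h2.lower_diff_le
  rw [hrA] at h3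
  rw [hrB] at h5
  refine ⟨union_mem_JSets hQJ h2.mem, (dMu_le_add _ _).trans ?_⟩
  have h7 : volume.real ((Q ∪ R₂) \ A) ≤ volume.real (Q \ A) := by
    refine real_le_of_subset_union_null ?_ ((IsJordan.of_mem hQJ).diff hAJ).ne_top h2.diff_lower
    rintro p ⟨hp | hp, hpA⟩
    · exact Or.inl ⟨hp, hpA⟩
    · exact Or.inr ⟨hp, fun h => hpA (hIA h)⟩
  have h9 : volume.real (Q \ A) ≤ volume.real (R₁ \ A) := by
    rw [measureReal_def, hQA]
    exact measureReal_mono (sdiff_subset_sdiff_left sdiff_subset) (h1J.diff hAJ).ne_top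
  have h8 : volume.real (A \ (Q ∪ R₂)) ≤ volume.real (I \ R₂) := by
    refine real_le_of_subset_union_null ?_ (hIJ.diff h2J).ne_top
      (measure_union_null h1.upper_diff (measure_union_null hnull hQnull))
    rintro p ⟨hpA, hp⟩
    rw [mem_union, not_or] at hp
    by_cases hp1 : p ∈ R₁
    · by_cases hpAB : p ∈ A ∩ B
      · by_cases hpI : p ∈ I
        · exact Or.inl ⟨hpI, hp.2⟩
        · exact Or.inr (Or.inr (Or.inl ⟨hpAB, hpI⟩))
      · exact Or.inr (Or.inr (Or.inr ⟨⟨hp1, hpAB⟩, hp.1⟩))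
    · exact Or.inr (Or.inl ⟨hpA, hp1⟩)
  linarith

theorem measureAvg_nonpos_spec (hn : 0 < n) (hA : A ∈ JSets n) (hB : B ∈ JSets n) (ht : t ≤ 0) :
    measureAvg P A B t ∈ JSets n ∧ dMu (measureAvg P A B t) B ≤ -t * dMu A B := by
  rcases ht.eq_or_lt with rfl | ht
  -- Weight zero, which occurs for `w = 0`, falls in the convex range of the definition.
  · have := convexAvg_spec (P := P) hn hA hB (left_mem_Icc.2 zero_le_one)
    exact ⟨this.1, by simpa using this.2.2⟩
  · unfold measureAvg
    rw [if_pos ht]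
    have := extrapAvg_spec (P := P) hn hB hA (t := 1 - t) (by linarith)
    refine ⟨this.1, ?_⟩
    rw [dMu_comm A B]
    refine this.2.trans (le_of_eq (by ring))

end measureAvg

theorem ne_top_of_mem_JSets {A : Set (E n)} (hA : A ∈ JSets n) : volume A ≠ ⊤ :=
  (IsJordan.of_mem hA).ne_top

/-- The distance between a set and one of two sets with bounded distances to it. -/
theorem dMu_le_of_le {A B C : Set (E n)} (hA : A ∈ JSets n) (hB : B ∈ JSets n) {a b : ℝ}
    (h₁ : dMu A B ≤ a) (h₂ : dMu B C ≤ b) : dMu A C ≤ a + b :=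
  (dMu_triangle (ne_top_of_mem_JSets hA) (ne_top_of_mem_JSets hB)).trans (add_le_add h₁ h₂)

/-! ### Contraction of the 4-point scheme. -/

section fourPoint

variable {P : AverageChoices n} {w : ℝ} {F₀ : ℤ → Set (E n)}

theorem fourPoint_even (k : ℕ) (i : ℤ) :
    fourPoint P w F₀ (k + 1) (2 * i) = fourPoint P w F₀ k i := by
  have h1 : (2 * i) / 2 = i := by omega
  simp [fourPoint, h1]

theorem fourPoint_odd (k : ℕ) (i : ℤ) :
    fourPoint P w F₀ (k + 1) (2 * i + 1) =
      measureAvg P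
        (measureAvg P (fourPoint P w F₀ k (i - 1)) (fourPoint P w F₀ k i) (-2 * w))
        (measureAvg P (fourPoint P w F₀ k (i + 2)) (fourPoint P w F₀ k (i + 1)) (-2 * w))
        (1 / 2) := by
  have h1 : (2 * i + 1) / 2 = i := by omega
  have h2 : ¬ Even (2 * i + 1) := by simp
  simp only [fourPoint, h1, if_neg h2]

/-- One refinement step contracts the distances of neighbours by the factor `1/2 + 4w`. -/
theorem refinement_spec (hn : 0 < n) (hw : 0 ≤ w) {A B C D : Set (E n)} (hA : A ∈ JSets n)
    (hB : B ∈ JSets n) (hC : C ∈ JSets n) (hD : D ∈ JSets n) {L : ℝ} (hAB : dMu A B ≤ L)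
    (hBC : dMu B C ≤ L) (hCD : dMu C D ≤ L) :
    measureAvg P (measureAvg P A B (-2 * w)) (measureAvg P D C (-2 * w)) (1 / 2) ∈ JSets n ∧
    dMu B (measureAvg P (measureAvg P A B (-2 * w)) (measureAvg P D C (-2 * w)) (1 / 2)) ≤
      (1 / 2 + 4 * w) * L ∧
    dMu (measureAvg P (measureAvg P A B (-2 * w)) (measureAvg P D C (-2 * w)) (1 / 2)) C ≤
      (1 / 2 + 4 * w) * L := by
  obtain ⟨hX, hXB⟩ := measureAvg_nonpos_spec (P := P) hn hA hB (t := -2 * w) (by linarith)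
  obtain ⟨hY, hYC⟩ := measureAvg_nonpos_spec (P := P) hn hD hC (t := -2 * w) (by linarith)
  set X := measureAvg P A B (-2 * w)
  set Y := measureAvg P D C (-2 * w)
  obtain ⟨hZ, hZX, hZY⟩ := convexAvg_spec (P := P) hn hX hY (t := 1 / 2) (by norm_num)
  set Z := measureAvg P X Y (1 / 2)
  have hXB : dMu X B ≤ 2 * w * L := hXB.trans (by nlinarith)
  have hYC : dMu Y C ≤ 2 * w * L := hYC.trans (by rw [dMu_comm D C]; nlinarith)
  -- The path `X, B, C, Y` has length at most `(1 + 4w)L`. Half of it, plus the displacement `2wL`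
  -- of an endpoint, is `(1/2 + 4w)L`.
  have hXY : dMu X Y ≤ 2 * w * L + (L + 2 * w * L) :=
    dMu_le_of_le hX hB hXB (dMu_le_of_le hB hC hBC (by rwa [dMu_comm]))
  refine ⟨hZ, ?_, ?_⟩
  · rw [dMu_comm]
    refine (dMu_le_of_le hZ hX hZX hXB).trans ?_
    linarith
  · refine (dMu_le_of_le hZ hY hZY hYC).trans ?_
    linarith

/-- Each pair of neighbours at a new level consists of an old set and an inserted one, so both
estimates of `refinement_spec` are used. -/
theorem fourPoint_spec (hn : 0 < n) (hw : 0 ≤ w) (hF : ∀ i, F₀ i ∈ JSets n) {L : ℝ}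
    (hL : ∀ i, dMu (F₀ i) (F₀ (i + 1)) ≤ L) (k : ℕ) :
    (∀ i, fourPoint P w F₀ k i ∈ JSets n) ∧
      ∀ i, dMu (fourPoint P w F₀ k i) (fourPoint P w F₀ k (i + 1)) ≤ (1 / 2 + 4 * w) ^ k * L := by
  induction k with
  | zero => exact ⟨hF, by simpa [fourPoint] using hL⟩
  | succ k ih =>
    have key : ∀ i, fourPoint P w F₀ (k + 1) (2 * i + 1) ∈ JSets n ∧
        dMu (fourPoint P w F₀ k i) (fourPoint P w F₀ (k + 1) (2 * i + 1)) ≤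
          (1 / 2 + 4 * w) * ((1 / 2 + 4 * w) ^ k * L) ∧
        dMu (fourPoint P w F₀ (k + 1) (2 * i + 1)) (fourPoint P w F₀ k (i + 1)) ≤
          (1 / 2 + 4 * w) * ((1 / 2 + 4 * w) ^ k * L) := by
      intro i
      rw [fourPoint_odd]
      refine refinement_spec hn hw (ih.1 _) (ih.1 _) (ih.1 _) (ih.1 _) ?_ (ih.2 i) ?_
      · simpa using ih.2 (i - 1)
      · simpa [add_assoc] using ih.2 (i + 1)
    rw [pow_succ']
    constructor
    · intro j
      obtain ⟨i, rfl | rfl⟩ := Int.even_or_odd' j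
      · rw [fourPoint_even]; exact ih.1 i
      · exact (key i).1
    · intro j
      rw [mul_assoc]
      obtain ⟨i, rfl | rfl⟩ := Int.even_or_odd' j
      · rw [fourPoint_even]; exact (key i).2.1
      · rw [show 2 * i + 1 + 1 = 2 * (i + 1) by ring, fourPoint_even]; exact (key i).2.2

end fourPoint

/-! ### Interpolants: consecutive levels and the initial error. -/

section interpolant

variable {P : AverageChoices n} {F : ℤ → Set (E n)} {δ h L : ℝ}

theorem interpolant_spec (hn : 0 < n) (hF : ∀ i, F i ∈ JSets n)
    (hL : ∀ i, dMu (F i) (F (i + 1)) ≤ L) (x : ℝ) :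
    interpolant P δ h F x ∈ JSets n ∧
      dMu (interpolant P δ h F x) (F ⌊(x - δ) / h⌋) ≤ Int.fract ((x - δ) / h) * L ∧
      dMu (interpolant P δ h F x) (F (⌊(x - δ) / h⌋ + 1)) ≤
        (1 - Int.fract ((x - δ) / h)) * L := by
  have hlam : (⌊(x - δ) / h⌋ + 1 : ℝ) - (x - δ) / h = 1 - Int.fract ((x - δ) / h) := by
    rw [Int.fract]; ring
  have h0 := Int.fract_nonneg ((x - δ) / h)
  have h1 := Int.fract_lt_one ((x - δ) / h)
  obtain ⟨hJ, hd₁, hd₂⟩ := convexAvg_spec (P := P) hn (hF ⌊(x - δ) / h⌋)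
    (hF (⌊(x - δ) / h⌋ + 1)) (t := 1 - Int.fract ((x - δ) / h)) ⟨by linarith, by linarith⟩
  unfold interpolant
  simp only [hlam]
  refine ⟨hJ, hd₁.trans ?_, hd₂.trans ?_⟩
  · rw [sub_sub_cancel]
    exact mul_le_mul_of_nonneg_left (hL _) h0
  · exact mul_le_mul_of_nonneg_left (hL _) (by linarith)

/-- The distance of the interpolants of two consecutive levels. -/
theorem dMu_interpolant_refine (hn : 0 < n) {F' : ℤ → Set (E n)} (hF : ∀ i, F i ∈ JSets n)
    (hF' : ∀ i, F' i ∈ JSets n) (heven : ∀ i, F' (2 * i) = F i)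
    (hL : ∀ i, dMu (F i) (F (i + 1)) ≤ L) {θ : ℝ} (hθ : 0 ≤ θ)
    (hL' : ∀ i, dMu (F' i) (F' (i + 1)) ≤ θ * L) (x : ℝ) :
    dMu (interpolant P δ h F x) (interpolant P δ (h / 2) F' x) ≤ (1 / 2 + θ) * L := by
  obtain ⟨hJ, h1, h2⟩ := interpolant_spec (P := P) (δ := δ) (h := h) hn hF hL x
  obtain ⟨hJ', h1', h2'⟩ := interpolant_spec (P := P) (δ := δ) (h := h / 2) hn hF' hL' x
  have hu : (x - δ) / (h / 2) = 2 * ((x - δ) / h) := by rw [div_div_eq_mul_div]; ring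
  rw [hu] at h1' h2'
  have hL0 : 0 ≤ L := (dMu_nonneg _ _).trans (hL 0)
  set u := (x - δ) / h
  have hfr := Int.self_sub_floor u
  have h0 := Int.fract_nonneg u
  have hlt := Int.fract_lt_one u
  -- Both interpolants are compared with the set at the nearest coarse node, which they share. At a
  -- fraction `φ ≤ 1/2` of the mesh from it, the distances are at most `φ * L` and `2 * φ * θ * L`.
  rcases lt_or_ge (Int.fract u) (1 / 2) with hc | hc
  · have hfl : ⌊2 * u⌋ = 2 * ⌊u⌋ := by
      rw [Int.floor_eq_iff]; push_cast; constructor <;> linarith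
    have hfr' : Int.fract (2 * u) = 2 * Int.fract u := by
      rw [← Int.self_sub_floor, hfl, ← hfr]; push_cast; ring
    rw [hfl, heven, hfr', dMu_comm] at h1'
    refine (dMu_le_of_le hJ (hF _) h1 h1').trans ?_
    have : Int.fract u * ((1 + 2 * θ) * L) ≤ 1 / 2 * ((1 + 2 * θ) * L) :=
      mul_le_mul_of_nonneg_right hc.le (by positivity)
    linarith
  · have hfl : ⌊2 * u⌋ = 2 * ⌊u⌋ + 1 := by
      rw [Int.floor_eq_iff]; push_cast; constructor <;> linarith
    have hfr' : Int.fract (2 * u) = 2 * Int.fract u - 1 := by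
      rw [← Int.self_sub_floor, hfl, ← hfr]; push_cast; ring
    rw [hfl, show 2 * ⌊u⌋ + 1 + 1 = 2 * (⌊u⌋ + 1) by ring, heven, hfr', dMu_comm] at h2'
    refine (dMu_le_of_le hJ (hF _) h2 h2').trans ?_
    have : (1 - Int.fract u) * ((1 + 2 * θ) * L) ≤ 1 / 2 * ((1 + 2 * θ) * L) :=
      mul_le_mul_of_nonneg_right (by linarith) (by positivity)
    linarith

/-- The distance of a Hölder continuous function and its piecewise interpolant. -/
theorem dMu_interpolant_sample (hn : 0 < n) {G : ℝ → Set (E n)} (hG : ∀ x, G x ∈ JSets n)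
    {H ν : ℝ} (hH : 0 ≤ H) (hν : 0 < ν) (hGH : ∀ s t : ℝ, dMu (G s) (G t) ≤ H * |s - t| ^ ν)
    (hh : 0 < h) (x : ℝ) :
    dMu (G x) (interpolant P δ h (fun i : ℤ => G (δ + i * h)) x) ≤
      (1 / 2 ^ ν + 1 / 2) * (H * h ^ ν) := by
  have hL : ∀ i : ℤ, dMu (G (δ + i * h)) (G (δ + (i + 1 : ℤ) * h)) ≤ H * h ^ ν := by
    intro i
    refine (hGH _ _).trans (le_of_eq ?_)
    have : δ + i * h - (δ + (i + 1 : ℤ) * h) = -h := by push_cast; ring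
    rw [this, abs_neg, abs_of_pos hh]
  obtain ⟨hJ, h1, h2⟩ := interpolant_spec (P := P) (δ := δ) (h := h)
    (F := fun i : ℤ => G (δ + i * h)) hn (fun i => hG _) hL x
  have hclose : ∀ s, |x - s| ≤ h / 2 → dMu (G x) (G s) ≤ 1 / 2 ^ ν * (H * h ^ ν) := by
    intro s hs
    refine (hGH x s).trans ?_
    calc H * |x - s| ^ ν ≤ H * (h / 2) ^ ν := by gcongr
      _ = 1 / 2 ^ ν * (H * h ^ ν) := by
        rw [Real.div_rpow hh.le zero_le_two]; ring
  have hx : x = δ + (x - δ) / h * h := by field_simp; ring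
  set u := (x - δ) / h
  have hfr := Int.self_sub_floor u
  have hlt := Int.fract_lt_one u
  have h0 := Int.fract_nonneg u
  have hD : 0 ≤ H * h ^ ν := by positivity
  rw [add_mul]
  -- The nearest node is within `h / 2`: the Hölder condition contributes `1 / 2 ^ ν` and
  -- interpolation contributes `1 / 2`.
  rcases le_total (Int.fract u) (1 / 2) with hc | hc
  · refine dMu_le_of_le (hG x) (hG _) (hclose (δ + ⌊u⌋ * h) ?_) ?_
    · have : x - (δ + ⌊u⌋ * h) = Int.fract u * h := by rw [← hfr]; linarith
      rw [this, abs_of_nonneg (by positivity)]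
      nlinarith
    · rw [dMu_comm]
      exact h1.trans (mul_le_mul_of_nonneg_right hc hD)
  · refine dMu_le_of_le (hG x) (hG _) (hclose (δ + (⌊u⌋ + 1 : ℤ) * h) ?_) ?_
    · have : x - (δ + (⌊u⌋ + 1 : ℤ) * h) = -((1 - Int.fract u) * h) := by
        rw [← hfr]; push_cast; linarith
      rw [this, abs_neg, abs_of_nonneg (mul_nonneg (by linarith) hh.le)]
      nlinarith
    · rw [dMu_comm]
      exact h2.trans (mul_le_mul_of_nonneg_right (by linarith) hD)

end interpolant

/-! ### Explicit limits of geometrically convergent sequences of sets. -/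

/-- The set of points lying in infinitely many sets of the sequence. -/
def limsupSet (A : ℕ → Set (E n)) : Set (E n) := ⋂ m, ⋃ k, A (m + k)

/-- A point whose membership never changes from index `k` on belongs to the upper limit exactly when
it belongs to `A k`. -/
theorem symmDiff_limsupSet_subset (A : ℕ → Set (E n)) (k : ℕ) :
    symmDiff (A k) (limsupSet A) ⊆ ⋃ j, symmDiff (A (k + j)) (A (k + (j + 1))) := by
  intro p hp
  by_contra hcon
  simp only [mem_iUnion, not_exists, mem_symmDiff, not_or, not_and, not_not] at hcon
  have hiff : ∀ j, p ∈ A (k + j) ↔ p ∈ A k := by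
    intro j
    induction j with
    | zero => rfl
    | succ j ih => rw [← ih]; exact ⟨(hcon j).2, (hcon j).1⟩
  have hlim : p ∈ limsupSet A ↔ p ∈ A k := by
    simp only [limsupSet, mem_iInter, mem_iUnion]
    constructor
    · intro h
      obtain ⟨j, hj⟩ := h k
      exact (hiff j).1 hj
    · intro h m
      exact ⟨k, by rw [add_comm]; exact (hiff m).2 h⟩
  rw [mem_symmDiff, hlim] at hp
  tauto

/-- A sequence with geometrically decreasing distances converges to its upper limit. -/
theorem limsupSet_spec {A : ℕ → Set (E n)} (hA : ∀ k, A k ∈ LSets n) {a θ : ℝ} (ha : 0 ≤ a)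
    (hθ0 : 0 ≤ θ) (hθ1 : θ < 1) (hd : ∀ k, dMu (A k) (A (k + 1)) ≤ a * θ ^ k) :
    limsupSet A ∈ LSets n ∧ ∀ k, dMu (A k) (limsupSet A) ≤ a / (1 - θ) * θ ^ k := by
  have hvol : ∀ k, volume (symmDiff (A k) (limsupSet A)) ≤
      ENNReal.ofReal (a / (1 - θ) * θ ^ k) := by
    intro k
    have hsum : HasSum (fun j => a * θ ^ (k + j)) (a / (1 - θ) * θ ^ k) := by
      have := (hasSum_geometric_of_lt_one hθ0 hθ1).mul_left (a * θ ^ k)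
      convert! this using 1
      · funext j; rw [pow_add, mul_assoc]
      · rw [div_eq_mul_inv]; ring
    calc volume (symmDiff (A k) (limsupSet A))
        ≤ ∑' j, volume (symmDiff (A (k + j)) (A (k + (j + 1)))) :=
          (measure_mono (symmDiff_limsupSet_subset A k)).trans (measure_iUnion_le _)
      _ ≤ ∑' j, ENNReal.ofReal (a * θ ^ (k + j)) := by
          refine ENNReal.tsum_le_tsum fun j => ?_
          have hfin : volume (symmDiff (A (k + j)) (A (k + (j + 1)))) ≠ ⊤ :=
            ((measure_mono symmDiff_subset_union).trans_lt ((measure_union_le _ _).trans_lt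
              (ENNReal.add_lt_top.2 ⟨(hA _).2, (hA _).2⟩))).ne
          rw [← ENNReal.ofReal_toReal hfin]
          exact ENNReal.ofReal_le_ofReal (hd (k + j))
      _ = ENNReal.ofReal (a / (1 - θ) * θ ^ k) := by
          rw [← ENNReal.ofReal_tsum_of_nonneg (fun j => by positivity) hsum.summable,
            hsum.tsum_eq]
  have hpos : ∀ k, 0 ≤ a / (1 - θ) * θ ^ k := fun k =>
    mul_nonneg (div_nonneg ha (by linarith)) (pow_nonneg hθ0 k)
  refine ⟨⟨?_, ?_⟩, fun k => ENNReal.toReal_le_of_le_ofReal (hpos k) (hvol k)⟩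
  · exact NullMeasurableSet.iInter fun m => NullMeasurableSet.iUnion fun k => (hA (m + k)).1
  · have hsub : limsupSet A ⊆ A 0 ∪ symmDiff (A 0) (limsupSet A) := fun p hp => by
      by_cases h : p ∈ A 0
      · exact Or.inl h
      · exact Or.inr (Or.inr ⟨hp, h⟩)
    refine (measure_mono hsub).trans_lt ((measure_union_le _ _).trans_lt ?_)
    exact ENNReal.add_lt_top.2 ⟨(hA 0).2, (hvol 0).trans_lt ENNReal.ofReal_lt_top⟩

end SetSubdivision

end

/-! ### Summation of the errors over all levels. -/

theorem theorem6p4 (n : ℕ) (hn : 0 < n) (P : SetSubdivision.AverageChoices n)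
    (w : ℝ) (hw0 : 0 ≤ w) (hw : w < 1 / 8)
    (ν H : ℝ) (hν0 : 0 < ν) (hν1 : ν ≤ 1)
    (G : ℝ → Set (SetSubdivision.E n)) (hG : ∀ x, G x ∈ SetSubdivision.JSets n)
    (hGH : ∀ s t : ℝ, SetSubdivision.dMu (G s) (G t) ≤ H * |s - t| ^ ν)
    (δ h : ℝ) (hh : 0 < h) (hδ0 : 0 ≤ δ) (hδ : δ < h) :
    let F : ℕ → ℝ → Set (SetSubdivision.E n) :=
      SetSubdivision.fourPointInterpolant P w δ h (fun i : ℤ => G (δ + i * h))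
    let C : ℝ := (1 / 2 ^ ν + 1 / 2 + (1 + 4 * w) / (1 / 2 - 4 * w)) * H
    (∀ k x, F k x ∈ SetSubdivision.JSets n ∧
      SetSubdivision.dMu (G x) (F k x) ≤ C * h ^ ν) ∧
    (∃ Finf : ℝ → Set (SetSubdivision.E n), SetSubdivision.IsUniformLimit F Finf) ∧
    (∀ Finf : ℝ → Set (SetSubdivision.E n), SetSubdivision.IsUniformLimit F Finf →
      ∀ x, SetSubdivision.dMu (Finf x) (G x) ≤ C * h ^ ν) := by
  intro F C
  have hH : 0 ≤ H := by
    have := (SetSubdivision.dMu_nonneg _ _).trans (hGH 1 0)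
    simpa using this
  have hF0 : ∀ i : ℤ, (fun i : ℤ => G (δ + i * h)) i ∈ SetSubdivision.JSets n := fun i => hG _
  set D := H * h ^ ν with hDdef
  have hD : 0 ≤ D := by positivity
  set θ := 1 / 2 + 4 * w with hθdef
  have hθ0 : 0 ≤ θ := by positivity
  have hθ1 : θ < 1 := by linarith
  have hL : ∀ i : ℤ, SetSubdivision.dMu ((fun i : ℤ => G (δ + i * h)) i)
      ((fun i : ℤ => G (δ + i * h)) (i + 1)) ≤ D := by
    intro i
    refine (hGH _ _).trans (le_of_eq ?_)
    have : δ + i * h - (δ + (i + 1 : ℤ) * h) = -h := by push_cast; ring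
    rw [this, abs_neg, abs_of_pos hh]
  have hspec := SetSubdivision.fourPoint_spec (P := P) hn hw0 hF0 hL
  have hFJ : ∀ k x, F k x ∈ SetSubdivision.JSets n := fun k x =>
    (SetSubdivision.interpolant_spec hn (hspec k).1 (hspec k).2 x).1
  have hstep : ∀ k x, SetSubdivision.dMu (F k x) (F (k + 1) x) ≤ (1 + 4 * w) * D * θ ^ k := by
    intro k x
    have := SetSubdivision.dMu_interpolant_refine (P := P) (δ := δ) (h := h / 2 ^ k) hn
      (hspec k).1 (hspec (k + 1)).1 (SetSubdivision.fourPoint_even k) (hspec k).2 hθ0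
      (fun i => ((hspec (k + 1)).2 i).trans_eq (by rw [pow_succ', mul_assoc])) x
    have hh2 : h / 2 ^ k / 2 = h / 2 ^ (k + 1) := by rw [div_div, pow_succ]
    rw [hh2] at this
    exact this.trans_eq (by rw [hθdef]; ring)
  have hbase : ∀ x, SetSubdivision.dMu (G x) (F 0 x) ≤ (1 / 2 ^ ν + 1 / 2) * D := by
    intro x
    have := SetSubdivision.dMu_interpolant_sample (P := P) (δ := δ) hn hG hH hν0 hGH hh x
    simpa [F, SetSubdivision.fourPointInterpolant, SetSubdivision.fourPoint] using this
  -- Since `1/2 - 4w = 1 - θ`, the last term of `C` is the full geometric series of the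
  -- level-to-level errors.
  have hCeq : C * h ^ ν = (1 / 2 ^ ν + 1 / 2) * D + (1 + 4 * w) * D * (1 - θ)⁻¹ := by
    have : 1 / 2 - 4 * w = 1 - θ := by rw [hθdef]; ring
    simp only [C, hDdef]
    rw [this]; ring
  have hpartial : ∀ k x, SetSubdivision.dMu (G x) (F k x) ≤
      (1 / 2 ^ ν + 1 / 2) * D + (1 + 4 * w) * D * ∑ j ∈ Finset.range k, θ ^ j := by
    intro k x
    induction k with
    | zero => simpa using hbase x
    | succ k ih =>
      rw [Finset.sum_range_succ, mul_add, ← add_assoc]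
      exact SetSubdivision.dMu_le_of_le (hG x) (hFJ k x) ih (hstep k x)
  have hmain : ∀ k x, SetSubdivision.dMu (G x) (F k x) ≤ C * h ^ ν := by
    intro k x
    refine (hpartial k x).trans ?_
    rw [hCeq, ← tsum_geometric_of_lt_one hθ0 hθ1]
    gcongr
    exact (summable_geometric_of_lt_one hθ0 hθ1).sum_le_tsum _ (fun j _ => pow_nonneg hθ0 j)
  have hFL : ∀ k x, F k x ∈ SetSubdivision.LSets n := fun k x =>
    ⟨(SetSubdivision.IsJordan.of_mem (hFJ k x)).nullMeasurableSet,
      (SetSubdivision.ne_top_of_mem_JSets (hFJ k x)).lt_top⟩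
  refine ⟨fun k x => ⟨hFJ k x, hmain k x⟩, ?_, ?_⟩
  · have ha : 0 ≤ (1 + 4 * w) * D := by positivity
    have hlim := fun x => SetSubdivision.limsupSet_spec (A := fun k => F k x) (fun k => hFL k x)
      ha hθ0 hθ1 (fun k => hstep k x)
    refine ⟨fun x => SetSubdivision.limsupSet fun k => F k x, fun x => (hlim x).1, ?_⟩
    intro η hη
    have htend : Filter.Tendsto (fun k => (1 + 4 * w) * D / (1 - θ) * θ ^ k) Filter.atTop
        (nhds 0) := by
      simpa using (tendsto_pow_atTop_nhds_zero_of_lt_one hθ0 hθ1).const_mul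
        ((1 + 4 * w) * D / (1 - θ))
    obtain ⟨K, hK⟩ := Filter.eventually_atTop.1 (htend.eventually_le_const hη)
    exact ⟨K, fun k hk x => ((hlim x).2 k).trans (hK k hk)⟩
  -- The bound on `G` versus `F k` is uniform in `k`, so one sufficiently high level suffices for
  -- each `η`, whichever limit is given.
  · intro Finf hFinf x
    refine le_of_forall_pos_le_add fun η hη => ?_
    obtain ⟨K, hK⟩ := hFinf.2 η hη
    have h1 := hK K le_rfl x
    rw [SetSubdivision.dMu_comm] at h1 ⊢
    rw [SetSubdivision.dMu_comm] at h1
    exact (SetSubdivision.dMu_triangle (SetSubdivision.ne_top_of_mem_JSets (hG x))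
      (SetSubdivision.ne_top_of_mem_JSets (hFJ K x))).trans (add_le_add (hmain K x) h1)
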